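/- Let $K$ be an algebraically closed field and let $\mathcal{C}$ be a skeletally small additive $K$-category which is $\mathrm{Hom}$-finite (all $\mathcal{C}(X,Y)$ are finite dimensional) and Krull–Schmidt (every object is a finite direct sum of objects with local endomorphism ring). A $\mathcal{C}$-module is a $K$-linear functor $\mathcal{C}^{op}\to\mathrm{Mod}(K)$. Let $$0=\mathcal{B}_0\subset\mathcal{B}_1\subset\mathcal{B}_2\subset\cdots\subset\mathcal{C},\qquad \bigcup_{i\ge 0}\mathcal{B}_i=\mathcal{C},$$ be an exhaustive filtration of $\mathcal{C}$ by full subcategories closed under direct summands, and let $I_{\mathcal{B}_i}(X,Y)\subset\mathcal{C}(X,Y)$ be the ideal generated by the morphisms that factor through an object of $\mathcal{B}_i$. Assume that $\mathcal{C}$ is quasi-hereditary with respect to $\{\mathcal{B}_i\}_{i\ge 0}$: for each $i\ge 1$ the ideal $I=I_{\mathcal{B}_i}/I_{\mathcal{B}_{i-1}}$ of the category $\mathcal{C}/I_{\mathcal{B}_{i-1}}$ is heredity, i.e. $I^2=I$, $I\,\mathrm{rad}\,I=0$, where $\mathrm{rad}$ is the Jacobson radical of $\mathcal{C}/I_{\mathcal{B}_{i-1}}$,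 and every $I(-,X)$ is a finitely generated projective $\mathcal{C}/I_{\mathcal{B}_{i-1}}$-module. For $j\ge 1$ put $$\Delta(j)=\Big\{\tfrac{\mathcal{C}(-,E)}{I_{\mathcal{B}_{j-1}}(-,E)}\;\Big|\;E\in\mathcal{B}_j\Big\},\quad \Delta^\circ(j)=\Big\{\tfrac{\mathcal{C}(E,-)}{I_{\mathcal{B}_{j-1}}(E,-)}\;\Big|\;E\in\mathcal{B}_j\Big\},\quad \nabla(j)=\{D M\mid M\in\Delta^\circ(j)\},$$ with $D=\mathrm{Hom}_K(-,K)$ taken pointwise. For a $\mathcal{C}$-module $F$ let $F^{(j)}\subset F$ be the trace of the modules $\mathcal{C}(-,E)$, $E\in\mathcal{B}_j$, i.e. the sum of the images of all morphisms $\mathcal{C}(-,E)\to F$ with $E\in\mathcal{B}_j$. Let $\mathcal{F}(\Delta)$ be the class of $\mathcal{C}$-modules $F$ such that, for every $i\ge 1$, $F^{(i)}/F^{(i-1)}$ is isomorphic to a finite direct sum of modules in $\Delta(i)$. Then: 1. $\mathcal{F}(\Delta)$ is closed under kernels of epimorphisms: if $0\to F'\to F\to G\to 0$ is an exact sequence of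 $\mathcal{C}$-modules with $F,G\in\mathcal{F}(\Delta)$, then $F'\in\mathcal{F}(\Delta)$. 2. If moreover the filtration is finite, i.e. $\mathcal{B}_n=\mathcal{C}$ for some $n$, then for every $F\in\mathcal{F}(\Delta)$, every $t\ge 1$ and every $j\ge 1$, $$\mathrm{Ext}^t(F,N)=0\ \text{ for all } N\in\nabla(j),\qquad \mathrm{Tor}_t(F,M)=0\ \text{ for all } M\in\Delta^\circ(j),$$ where $\mathrm{Ext}$ is computed in the category of all $\mathcal{C}$-modules and $\mathrm{Tor}_t(-,M)$ is the $t$-th left derived functor of $-\otimes_{\mathcal{C}}M$. -/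

import Mathlib

open CategoryTheory CategoryTheory.Limits Opposite
open scoped TensorProduct DirectSum

universe v u

namespace QuasiHereditary

noncomputable section

section Modules

/-- The opposite of a `K`-linear category is `K`-linear. -/
instance opLinear (K : Type v) [Field K] (D : Type u) [Category.{v} D] [Preadditive D]
    [Linear K D] : Linear K Dᵒᵖ where
  homModule X Y :=
    { smul := fun r f => (r • f.unop).op
      one_smul := fun f => Quiver.Hom.unop_inj (one_smul K f.unop)
      mul_smul := fun r s f => Quiver.Hom.unop_inj (mul_smul r s f.unop)
      smul_zero := fun r => Quiver.Hom.unop_inj (smul_zero (A := unop Y ⟶ unop X) r)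
      smul_add := fun r f g => Quiver.Hom.unop_inj (smul_add r f.unop g.unop)
      add_smul := fun r s f => Quiver.Hom.unop_inj (add_smul r s f.unop)
      zero_smul := fun f => Quiver.Hom.unop_inj (zero_smul K f.unop) }
  smul_comp _ _ _ r f g := Quiver.Hom.unop_inj (Linear.comp_smul _ _ _ g.unop r f.unop)
  comp_smul _ _ _ f r g := Quiver.Hom.unop_inj (Linear.smul_comp _ _ _ r g.unop f.unop)

variable (K : Type v) [Field K] (D : Type u) [Category.{v} D] [Preadditive D] [Linear K D]

/-- The property of being a `K`-linear functor `D ⥤ Mod K`. -/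
def isLinear : ObjectProperty (D ⥤ ModuleCat.{v} K) := fun F => F.Additive ∧ F.Linear K

/-- The category of `K`-linear functors from `D` to `K`-vector spaces. With `D = C`, these are the
covariant, and with `D = Cᵒᵖ` the contravariant `C`-modules. -/
abbrev LMod := (isLinear K D).FullSubcategory

instance (M : LMod K D) : M.obj.Additive := M.property.1
instance (M : LMod K D) : M.obj.Linear K := M.property.2

instance : (isLinear K D).IsClosedUnderSubobjects where
  prop_of_mono {X Y} f _ hY := by
    obtain ⟨_, _⟩ := hY
    exact ⟨⟨fun {A B g h} => by
      rw [← cancel_mono (f.app B)]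
      simp [Preadditive.add_comp, Functor.map_add]⟩, ⟨fun {A B} g r => by
      rw [← cancel_mono (f.app B)]
      simp [Linear.smul_comp]⟩⟩

instance : (isLinear K D).IsClosedUnderQuotients where
  prop_of_epi {X Y} f _ hX := by
    obtain ⟨_, _⟩ := hX
    exact ⟨⟨fun {A B g h} => by
      rw [← cancel_epi (f.app A)]
      simp [← NatTrans.naturality, Preadditive.comp_add, Functor.map_add]⟩, ⟨fun {A B} g r => by
      rw [← cancel_epi (f.app A)]
      simp [← NatTrans.naturality, Linear.comp_smul]⟩⟩

instance : (isLinear K D).ContainsZero where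
  exists_zero := ⟨(Functor.const D).obj (ModuleCat.of K PUnit.{v + 1}),
    Functor.isZero _ (fun X => by
      dsimp
      exact ModuleCat.isZero_of_subsingleton _),
    ⟨fun {A B g h} => by ext x; exact Subsingleton.elim (α := PUnit.{v + 1}) _ _⟩,
    ⟨fun {A B} g r => by ext x; exact Subsingleton.elim (α := PUnit.{v + 1}) _ _⟩⟩

instance (J : Type) : (isLinear K D).IsClosedUnderLimitsOfShape (Discrete J) where
  limitsOfShape_le := by
    rintro F ⟨p⟩
    have hl : ∀ B, IsLimit (((evaluation D (ModuleCat.{v} K)).obj B).mapCone p.cone) :=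
      fun B => isLimitOfPreserves _ p.isLimit
    have nat : ∀ (j : Discrete J) {A B : D} (g : A ⟶ B),
        F.map g ≫ (p.π.app j).app B = (p.π.app j).app A ≫ (p.diag.obj j).map g :=
      fun j _ _ g => (p.π.app j).naturality g
    refine ⟨⟨fun {A B g h} => (hl B).hom_ext fun j => ?_⟩,
      ⟨fun {A B} g r => (hl B).hom_ext fun j => ?_⟩⟩
    · have := (p.prop_diag_obj j).1
      change F.map _ ≫ (p.π.app j).app B = (F.map _ + F.map _) ≫ (p.π.app j).app B
      rw [Preadditive.add_comp, nat, nat, nat, Functor.map_add, Preadditive.comp_add]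
    · have := (p.prop_diag_obj j).2
      change F.map _ ≫ (p.π.app j).app B = (r • F.map _) ≫ (p.π.app j).app B
      rw [Linear.smul_comp, nat, nat, Functor.map_smul, Linear.comp_smul]

instance : (isLinear K D).IsClosedUnderFiniteProducts where

instance (J : Type v) : (isLinear K D).IsClosedUnderColimitsOfShape (Discrete J) where
  colimitsOfShape_le := by
    rintro F ⟨p⟩
    have hl : ∀ A, IsColimit (((evaluation D (ModuleCat.{v} K)).obj A).mapCocone p.cocone) :=
      fun A => isColimitOfPreserves _ p.isColimit
    have nat : ∀ (j : Discrete J) {A B : D} (g : A ⟶ B),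
        (p.ι.app j).app A ≫ F.map g = (p.diag.obj j).map g ≫ (p.ι.app j).app B :=
      fun j _ _ g => ((p.ι.app j).naturality g).symm
    refine ⟨⟨fun {A B g h} => (hl A).hom_ext fun j => ?_⟩,
      ⟨fun {A B} g r => (hl A).hom_ext fun j => ?_⟩⟩
    · have := (p.prop_diag_obj j).1
      change (p.ι.app j).app A ≫ F.map _ = (p.ι.app j).app A ≫ (F.map _ + F.map _)
      rw [Preadditive.comp_add, nat, nat, nat, Functor.map_add, Preadditive.add_comp]
    · have := (p.prop_diag_obj j).2
      change (p.ι.app j).app A ≫ F.map _ = (p.ι.app j).app A ≫ (r • F.map _)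
      rw [Linear.comp_smul, nat, nat, Functor.map_smul, Linear.smul_comp]

instance : Abelian (LMod K D) := inferInstance

instance : HasFiniteBiproducts (LMod K D) := Abelian.hasFiniteBiproducts

instance : HasCoproducts.{v} (LMod K D) := fun J =>
  inferInstanceAs (HasColimitsOfShape (Discrete J) (isLinear K D).FullSubcategory)

instance : HasExt.{max u (v + 1)} (LMod K D) := HasExt.standard _

variable {D}

/-- The contravariant representable module `D(-, X)`. -/
def rep (X : D) : LMod K Dᵒᵖ :=
  ⟨(linearYoneda K D).obj X, inferInstance, ⟨fun f r => by
    ext g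
    exact Linear.smul_comp _ _ _ r f.unop g⟩⟩

/-- The covariant representable module `D(X, -)`. -/
def corep (X : D) : LMod K D :=
  ⟨(linearCoyoneda K D).obj (op X), inferInstance, ⟨fun f r => by
    ext g
    exact Linear.comp_smul _ _ _ g r f⟩⟩


theorem epi_iff_surjective {M N : LMod K D} (p : M ⟶ N) :
    Epi p ↔ ∀ X, Function.Surjective (p.hom.app X).hom := by
  have := (isLinear K D).preservesEpimorphisms_ι_of_isNormalMonoCategory
  constructor
  · intro _ X
    have h : Epi ((isLinear K D).ι.map p) := inferInstance
    exact (ModuleCat.epi_iff_surjective _).1 ((NatTrans.epi_iff_epi_app _).1 h X)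
  · intro h
    have : Epi ((isLinear K D).ι.map p) :=
      (NatTrans.epi_iff_epi_app _).2 fun X => (ModuleCat.epi_iff_surjective _).2 (h X)
    exact (isLinear K D).ι.epi_of_epi_map this

/-- The morphism `D(-, X) ⟶ M` that corresponds to an element of `M X`. -/
def repHom {X : D} {M : LMod K Dᵒᵖ} (x : M.obj.obj (op X)) : rep K X ⟶ M :=
  ObjectProperty.homMk
    { app := fun Y => ModuleCat.ofHom
        { toFun := fun g : unop Y ⟶ X => (M.obj.map g.op).hom x
          map_add' := fun g h => by rw [op_add, Functor.map_add]; rfl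
          map_smul' := fun r g => by
            have : (r • g).op = r • g.op := rfl
            rw [this, Functor.map_smul]; rfl }
      naturality := fun Y Z f => by
        ext g
        change (M.obj.map (f.unop ≫ g).op).hom x = (M.obj.map f).hom ((M.obj.map g.op).hom x)
        have h : (f.unop ≫ (show unop Y ⟶ X from g)).op =
          (show unop Y ⟶ X from g).op ≫ f := rfl
        exact ConcreteCategory.congr_hom ((congrArg M.obj.map h).trans (M.obj.map_comp _ _)) x }

theorem repHom_app {X : D} {M : LMod K Dᵒᵖ} (x : M.obj.obj (op X)) (Y : Dᵒᵖ) (g : unop Y ⟶ X) :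
    ((repHom K x).hom.app Y).hom g = (M.obj.map g.op).hom x := rfl

theorem repHom_id {X : D} {M : LMod K Dᵒᵖ} (x : M.obj.obj (op X)) :
    ((repHom K x).hom.app (op X)).hom (𝟙 X) = x := by
  rw [repHom_app]; simp

theorem rep_hom_ext {X : D} {M : LMod K Dᵒᵖ} {f g : rep K X ⟶ M}
    (h : (f.hom.app (op X)).hom (𝟙 X) = (g.hom.app (op X)).hom (𝟙 X)) : f = g := by
  have key : ∀ (f : rep K X ⟶ M) (Y : Dᵒᵖ) (a : unop Y ⟶ X),
      (f.hom.app Y).hom a = (M.obj.map a.op).hom ((f.hom.app (op X)).hom (𝟙 X)) := by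
    intro f Y a
    have := ConcreteCategory.congr_hom (f.hom.naturality a.op) (𝟙 X)
    have h2 : ((rep K X).obj.map a.op).hom (𝟙 X) = a := Category.comp_id a
    calc (f.hom.app Y).hom a
        = (f.hom.app Y).hom (((rep K X).obj.map a.op).hom (𝟙 X)) := by rw [h2]
      _ = _ := this
  ext Y a
  exact (key f Y a).trans (by rw [h]; exact (key g Y a).symm)

instance (X : D) : Projective (rep K X) where
  factors {E M} f e _ := by
    obtain ⟨x, hx⟩ := (epi_iff_surjective K e).1 inferInstance (op X)
      ((f.hom.app (op X)).hom (𝟙 X))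
    refine ⟨repHom K x, rep_hom_ext K ?_⟩
    change (e.hom.app (op X)).hom (((repHom K x).hom.app (op X)).hom (𝟙 X)) = _
    rw [repHom_id, hx]

theorem projective_sigma {J : Type v} (E : J → D) : Projective (∐ fun i => rep K (E i)) where
  factors {N M} f e _ := by
    refine ⟨Sigma.desc fun b => Projective.factorThru (Sigma.ι (fun i => rep K (E i)) b ≫ f) e, ?_⟩
    refine Sigma.hom_ext _ _ fun b => ?_
    rw [Sigma.ι_desc_assoc, Projective.factorThru_comp]

instance [EssentiallySmall.{v} D] : EnoughProjectives (LMod K Dᵒᵖ) where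
  presentation M := by
    let e := equivSmallModel.{v} D
    let E : SmallModel.{v} D → D := e.inverse.obj
    let p : (∐ fun i : (Σ s, (M.obj.obj (op (E s)) : Type v)) => rep K (E i.1)) ⟶ M :=
      Sigma.desc fun i => repHom K i.2
    have hp : Epi p := (epi_iff_surjective K p).2 ?_
    · exact ⟨{ p := _, f := p, projective := projective_sigma K _, epi := hp }⟩
    rintro ⟨X⟩ x
    let a : E (e.functor.obj X) ≅ X := (e.unitIso.app X).symm
    let i : (Σ s, (M.obj.obj (op (E s)) : Type v)) := ⟨e.functor.obj X, (M.obj.map a.hom.op).hom x⟩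
    have hi : Sigma.ι (fun i : (Σ s, (M.obj.obj (op (E s)) : Type v)) => rep K (E i.1)) i ≫ p =
      repHom K i.2 := Sigma.ι_desc _ _
    refine ⟨((Sigma.ι (fun i : (Σ s, (M.obj.obj (op (E s)) : Type v)) => rep K (E i.1)) i).hom.app _).hom
      a.inv, ?_⟩
    have h1 : ((repHom K i.2).hom.app (op X)).hom a.inv = x := by
      rw [repHom_app]
      change ((M.obj.map a.hom.op) ≫ (M.obj.map a.inv.op)).hom x = x
      rw [← Functor.map_comp, ← op_comp, a.inv_hom_id]
      simp
    rw [← hi] at h1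
    exact h1

variable {K}

/-- A submodule of a module `M`: a family of subspaces stable under the action of morphisms. -/
structure Sub (M : LMod K D) where
  carrier : ∀ X, Submodule K (M.obj.obj X)
  map_mem : ∀ {X Y : D} (f : X ⟶ Y) (x : M.obj.obj X),
    x ∈ carrier X → (M.obj.map f).hom x ∈ carrier Y

namespace Sub

variable {M : LMod K D}

/-- A submodule, as a module. -/
def toLMod (N : Sub M) : LMod K D :=
  ⟨{ obj := fun X => ModuleCat.of K (N.carrier X)
     map := fun f => ModuleCat.ofHom ((M.obj.map f).hom.restrict (N.map_mem f))
     map_id := fun X => by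
       ext x
       exact ConcreteCategory.congr_hom (M.obj.map_id X) x.1
     map_comp := fun f g => by
       ext x
       exact ConcreteCategory.congr_hom (M.obj.map_comp f g) x.1 },
   ⟨fun {X Y f g} => by
      ext x
      exact ConcreteCategory.congr_hom (M.obj.map_add (f := f) (g := g)) x.1⟩,
   ⟨fun f r => by
      ext x
      exact ConcreteCategory.congr_hom (M.obj.map_smul r f) x.1⟩⟩

/-- The quotient module `M / N`. -/
def quot (N : Sub M) : LMod K D :=
  ⟨{ obj := fun X => ModuleCat.of K (M.obj.obj X ⧸ N.carrier X)
     map := fun f => ModuleCat.ofHom (Submodule.mapQ _ _ (M.obj.map f).hom (N.map_mem f))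
     map_id := fun X => by
       ext x
       simp
     map_comp := fun f g => by
       ext x
       simp },
   ⟨fun {X Y f g} => by
      ext x
      simp [Functor.map_add]⟩,
   ⟨fun f r => by
      ext x
      simp [Functor.map_smul]⟩⟩

/-- The submodule `N ∩ N'` of the module `N'`; its quotient is `N' / N` when `N ⊆ N'`. -/
def restrict (N N' : Sub M) : Sub N'.toLMod where
  carrier X := (N.carrier X).comap (N'.carrier X).subtype
  map_mem f x hx := N.map_mem f x.1 hx

end Sub

/-- The dual `DM = Hom_K(M(-), K)` of a module. -/
def dual (M : LMod K D) : LMod K Dᵒᵖ :=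
  ⟨{ obj := fun X => ModuleCat.of K (Module.Dual K (M.obj.obj (unop X)))
     map := fun f => ModuleCat.ofHom (M.obj.map f.unop).hom.dualMap
     map_id := fun X => by ext; simp
     map_comp := fun f g => by ext; simp },
   ⟨fun {X Y f g} => by
      ext φ x
      simp [Functor.map_add]⟩,
   ⟨fun f r => by
      ext φ x
      have : (r • f).unop = r • f.unop := rfl
      simp [this, Functor.map_smul]⟩⟩

/-- A module is finitely generated if it is a quotient of a finite sum of representable modules. -/
def IsFinitelyGenerated (M : LMod K Dᵒᵖ) : Prop :=
  ∃ (n : ℕ) (E : Fin n → D) (p : (⨁ fun k => rep K (E k)) ⟶ M), Epi p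

end Modules

section Tensor

variable {K : Type v} [Field K] {D : Type u} [Category.{v} D] [Preadditive D] [Linear K D]

open Classical in
/-- The relations `F(f) x ⊗ y = x ⊗ G(f) y` that define the tensor product `F ⊗_D G`. -/
def tensorRel (F : LMod K Dᵒᵖ) (G : LMod K D) :
    Submodule K (⨁ X : D, F.obj.obj (op X) ⊗[K] G.obj.obj X) :=
  Submodule.span K {t | ∃ (X Y : D) (f : X ⟶ Y) (x : F.obj.obj (op Y)) (y : G.obj.obj X),
    t = DirectSum.lof K D (fun X => F.obj.obj (op X) ⊗[K] G.obj.obj X) X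
          ((F.obj.map f.op).hom x ⊗ₜ[K] y) -
        DirectSum.lof K D (fun X => F.obj.obj (op X) ⊗[K] G.obj.obj X) Y
          (x ⊗ₜ[K] (G.obj.map f).hom y)}

/-- The map induced by a morphism of modules before passing to the quotient by the relations. -/
def tensorPre {F F' : LMod K Dᵒᵖ} (φ : F ⟶ F') (G : LMod K D) :
    (⨁ X : D, F.obj.obj (op X) ⊗[K] G.obj.obj X) →ₗ[K]
      ⨁ X : D, F'.obj.obj (op X) ⊗[K] G.obj.obj X :=
  DirectSum.lmap fun X => LinearMap.rTensor (G.obj.obj X) (φ.hom.app (op X)).hom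

theorem tensorPre_rel {F F' : LMod K Dᵒᵖ} (φ : F ⟶ F') (G : LMod K D) :
    tensorRel F G ≤ (tensorRel F' G).comap (tensorPre φ G) := by
  classical
  refine Submodule.span_le.2 ?_
  rintro _ ⟨X, Y, f, x, y, rfl⟩
  refine Submodule.subset_span ⟨X, Y, f, (φ.hom.app (op Y)).hom x, y, ?_⟩
  have nat : (φ.hom.app (op X)).hom ((F.obj.map f.op).hom x) =
      (F'.obj.map f.op).hom ((φ.hom.app (op Y)).hom x) :=
    ConcreteCategory.congr_hom (φ.hom.naturality f.op) x
  simp only [tensorPre, map_sub, DirectSum.lmap_lof, LinearMap.rTensor_tmul, nat]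

/-- The tensor product functor `- ⊗_D G`, with values in `K`-vector spaces. -/
def tensor (G : LMod K D) : LMod K Dᵒᵖ ⥤ ModuleCat.{max u v} K where
  obj F := ModuleCat.of K ((⨁ X : D, F.obj.obj (op X) ⊗[K] G.obj.obj X) ⧸ tensorRel F G)
  map φ := ModuleCat.ofHom (Submodule.mapQ _ _ (tensorPre φ G) (tensorPre_rel φ G))
  map_id F := by
    have : tensorPre (𝟙 F) G = LinearMap.id := by
      rw [← DirectSum.lmap_id]
      unfold tensorPre
      congr 1
      funext X
      exact LinearMap.rTensor_id _ _
    ext x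
    simp [this]
  map_comp {F F' F''} φ ψ := by
    have : tensorPre (φ ≫ ψ) G = tensorPre ψ G ∘ₗ tensorPre φ G := by
      unfold tensorPre
      rw [← DirectSum.lmap_comp]
      congr 1
      funext X
      exact LinearMap.rTensor_comp _ _ _
    ext x
    simp [this]

instance (G : LMod K D) : (tensor G).Additive where
  map_add {F F' φ ψ} := by
    classical
    have : tensorPre (φ + ψ) G = tensorPre φ G + tensorPre ψ G := by
      unfold tensorPre
      refine DirectSum.linearMap_ext _ fun X => LinearMap.ext fun t => ?_
      simp only [LinearMap.comp_apply, LinearMap.add_apply, DirectSum.lmap_lof, ← map_add]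
      congr 1
      exact LinearMap.congr_fun (LinearMap.rTensor_add _ _ _) t
    ext x
    obtain ⟨x, rfl⟩ := Submodule.Quotient.mk_surjective _ x
    have h : tensorPre (φ + ψ) G x = tensorPre φ G x + tensorPre ψ G x := by
      rw [this]; rfl
    exact congrArg (Submodule.Quotient.mk (p := tensorRel F' G)) h

/-- `Tor_t(F, G)`, the `t`-th left derived functor of `- ⊗_D G` evaluated at `F`. -/
def Tor [EssentiallySmall.{v} D] (t : ℕ) (F : LMod K Dᵒᵖ) (G : LMod K D) :
    ModuleCat.{max u v} K :=
  ((tensor G).leftDerived t).obj F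

end Tensor


section Ideals

variable (K : Type v) [Field K] (D : Type u) [Category.{v} D] [Preadditive D] [Linear K D]

/-- A two-sided ideal of a `K`-linear category: a subbifunctor of `Hom`. -/
@[ext]
structure CatIdeal where
  carrier : ∀ X Y : D, Submodule K (X ⟶ Y)
  comp_mem_left : ∀ {W X Y : D} (g : W ⟶ X) (f : X ⟶ Y), f ∈ carrier X Y → g ≫ f ∈ carrier W Y
  comp_mem_right : ∀ {X Y Z : D} (f : X ⟶ Y) (g : Y ⟶ Z), f ∈ carrier X Y → f ≫ g ∈ carrier X Z

variable {K D}

/-- A set of morphisms stable under composition on both sides spans an ideal. -/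
def CatIdeal.ofSpan (S : ∀ X Y : D, Set (X ⟶ Y))
    (hl : ∀ {W X Y : D} (g : W ⟶ X) (f : X ⟶ Y), f ∈ S X Y → g ≫ f ∈ S W Y)
    (hr : ∀ {X Y Z : D} (f : X ⟶ Y) (g : Y ⟶ Z), f ∈ S X Y → f ≫ g ∈ S X Z) :
    CatIdeal K D where
  carrier X Y := Submodule.span K (S X Y)
  comp_mem_left {W _ Y} g _ hf :=
    (Submodule.span_le (p := (Submodule.span K (S W Y)).comap (Linear.leftComp K Y g))).2
      (fun f hf => Submodule.subset_span (hl g f hf)) hf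
  comp_mem_right {X _ Z} _ g hf :=
    (Submodule.span_le (p := (Submodule.span K (S X Z)).comap (Linear.rightComp K X g))).2
      (fun f hf => Submodule.subset_span (hr f g hf)) hf

variable (K) in
/-- The ideal `I_P` generated by the morphisms that factor through some object satisfying `P`
(when `P` is closed under finite sums, these morphisms already form a subspace). -/
def factorIdeal (P : ObjectProperty D) : CatIdeal K D :=
  CatIdeal.ofSpan (fun X Y => {f | ∃ (E : D) (g : X ⟶ E) (h : E ⟶ Y), P E ∧ f = g ≫ h})
    (by
      rintro W X Y a _ ⟨E, g, h, hE, rfl⟩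
      exact ⟨E, a ≫ g, h, hE, by simp⟩)
    (by
      rintro X Y Z _ a ⟨E, g, h, hE, rfl⟩
      exact ⟨E, g, h ≫ a, hE, by simp⟩)

namespace CatIdeal

/-- The product of two ideals: finite sums of composites `X ⟶ Y ⟶ Z` with the first morphism in
`I` and the second one in `J`. -/
def mul (I J : CatIdeal K D) : CatIdeal K D :=
  ofSpan (fun X Z => {f | ∃ (Y : D) (g : X ⟶ Y) (h : Y ⟶ Z),
      g ∈ I.carrier X Y ∧ h ∈ J.carrier Y Z ∧ f = g ≫ h})
    (by
      rintro W X Y a _ ⟨E, g, h, hg, hh, rfl⟩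
      exact ⟨E, a ≫ g, h, I.comp_mem_left a g hg, hh, by simp⟩)
    (by
      rintro X Y Z _ a ⟨E, g, h, hg, hh, rfl⟩
      exact ⟨E, g, h ≫ a, hg, J.comp_mem_right h a hh, by simp⟩)

/-- The submodule `I(-, X)` of `D(-, X)`. -/
def row (I : CatIdeal K D) (X : D) : Sub (rep K X) where
  carrier Y := I.carrier (unop Y) X
  map_mem f x hx := I.comp_mem_left f.unop x hx

/-- The submodule `I(X, -)` of `D(X, -)`. -/
def col (I : CatIdeal K D) (X : D) : Sub (corep K X) where
  carrier Y := I.carrier X Y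
  map_mem f x hx := I.comp_mem_right x f hx

/-- Congruence of morphisms modulo an ideal. -/
def rel (I : CatIdeal K D) : HomRel D := fun X Y f g => f - g ∈ I.carrier X Y

theorem rel_iff (I : CatIdeal K D) {X Y : D} (f g : X ⟶ Y) :
    I.rel f g ↔ f - g ∈ I.carrier X Y := Iff.rfl

instance (I : CatIdeal K D) : Congruence I.rel where
  equivalence :=
    { refl := fun f => by rw [rel_iff, sub_self]; exact Submodule.zero_mem _
      symm := fun {f g} h => by
        rw [rel_iff, ← neg_sub]; exact Submodule.neg_mem _ h
      trans := fun {f g h} h₁ h₂ => by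
        rw [rel_iff, ← sub_add_sub_cancel f g h]; exact Submodule.add_mem _ h₁ h₂ }
  comp_left f g g' h := by
    rw [rel_iff, ← Preadditive.comp_sub]; exact I.comp_mem_left _ _ h
  comp_right g h := by
    rw [rel_iff, ← Preadditive.sub_comp]; exact I.comp_mem_right _ _ h

/-- The quotient category `D / I`. -/
abbrev Quot (I : CatIdeal K D) : Type u := CategoryTheory.Quotient I.rel

instance (I : CatIdeal K D) : Preadditive I.Quot :=
  Quotient.preadditive I.rel fun _ _ f₁ f₂ g₁ g₂ hf hg => by
    rw [rel_iff, add_sub_add_comm]; exact Submodule.add_mem _ hf hg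

instance (I : CatIdeal K D) : (Quotient.functor I.rel).Additive where
  map_add := rfl

instance (I : CatIdeal K D) : Linear K I.Quot :=
  Quotient.linear K I.rel fun a _ _ f₁ f₂ h => by
    rw [rel_iff, ← smul_sub]; exact Submodule.smul_mem _ a h

instance (I : CatIdeal K D) : (Quotient.functor I.rel).Linear K where
  map_smul _ _ := rfl

/-- The image of the ideal `J` in the category `D / I`; it is `J / I` when `I ⊆ J`. -/
def image (J I : CatIdeal K D) : CatIdeal K I.Quot where
  carrier X Y := (J.carrier X.as Y.as).map
    ((Quotient.functor I.rel).mapLinearMap K (X := X.as) (Y := Y.as))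
  comp_mem_left := by
    rintro W X Y g _ ⟨f, hf, rfl⟩
    obtain ⟨g, rfl⟩ := (Quotient.functor I.rel).map_surjective (X := W.as) (Y := X.as) g
    exact ⟨g ≫ f, J.comp_mem_left g f hf, (Quotient.functor I.rel).map_comp g f⟩
  comp_mem_right := by
    rintro X Y Z _ g ⟨f, hf, rfl⟩
    obtain ⟨g, rfl⟩ := (Quotient.functor I.rel).map_surjective (X := Y.as) (Y := Z.as) g
    exact ⟨f ≫ g, J.comp_mem_right f g hf, (Quotient.functor I.rel).map_comp f g⟩

end CatIdeal

/-- Membership in the Jacobson radical of a category. -/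
def InRadical {X Y : D} (f : X ⟶ Y) : Prop := ∀ g : Y ⟶ X, IsIso (𝟙 X - f ≫ g)

/-- Heredity ideals: `I² = I`, `I rad I = 0`, and every `I(-, X)` is a finitely generated
projective module. -/
structure IsHeredity (I : CatIdeal K D) : Prop where
  idempotent : I.mul I = I
  radical : ∀ {W X Y Z : D} (f : W ⟶ X) (r : X ⟶ Y) (g : Y ⟶ Z),
    f ∈ I.carrier W X → InRadical r → g ∈ I.carrier Y Z → f ≫ r ≫ g = 0
  projective : ∀ X : D, IsFinitelyGenerated (I.row X).toLMod ∧ Projective (I.row X).toLMod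

end Ideals

section QuasiHereditary

variable (K : Type v) [Field K] (C : Type u) [Category.{v} C] [Preadditive C] [Linear K C]

/-- All spaces of morphisms are finite dimensional. -/
def HomFinite : Prop := ∀ X Y : C, Module.Finite K (X ⟶ Y)

/-- Every object is a finite sum of objects with local endomorphism ring. -/
def IsKrullSchmidt [HasFiniteBiproducts C] : Prop :=
  ∀ X : C, ∃ (n : ℕ) (Y : Fin n → C), (∀ k, IsLocalRing (End (Y k))) ∧ Nonempty (X ≅ ⨁ Y)

variable {C}

/-- An exhaustive filtration `0 = B 0 ⊆ B 1 ⊆ ...` of a category by full subcategories that are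
closed under direct summands. -/
structure IsExhaustiveFiltration (B : ℕ → ObjectProperty C) : Prop where
  zero : ∀ X, B 0 X ↔ IsZero X
  mono : Monotone B
  summands : ∀ i, (B i).IsStableUnderRetracts
  exhaustive : ∀ X, ∃ i, B i X

/-- The category is quasi-hereditary with respect to the filtration `B`: the ideal
`I_{B (i + 1)} / I_{B i}` of the category `C / I_{B i}` is heredity for every `i`. -/
def IsQuasiHereditary (B : ℕ → ObjectProperty C) : Prop :=
  ∀ i, IsHeredity ((factorIdeal K (B (i + 1))).image (factorIdeal K (B i)))

/-- For `E` in `B (i + 1)`, the standard module `Δ_E(i + 1) = C(-, E) / I_{B i}(-, E)`. -/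
def standard (B : ℕ → ObjectProperty C) (i : ℕ) (E : C) : LMod K Cᵒᵖ :=
  ((factorIdeal K (B i)).row E).quot

/-- For `E` in `B (i + 1)`, the covariant standard module `Δ°_E(i + 1) = C(E, -) / I_{B i}(E, -)`. -/
def standardOp (B : ℕ → ObjectProperty C) (i : ℕ) (E : C) : LMod K C :=
  ((factorIdeal K (B i)).col E).quot

/-- For `E` in `B (i + 1)`, the costandard module `∇_E(i + 1) = D Δ°_E(i + 1)`. -/
def costandard (B : ℕ → ObjectProperty C) (i : ℕ) (E : C) : LMod K Cᵒᵖ :=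
  dual (standardOp K B i E)

variable {K}

/-- The trace in `F` of the representable modules `C(-, E)` with `E` in `P`: the sum of the images
of all morphisms `C(-, E) ⟶ F`. -/
def trace (P : ObjectProperty C) (F : LMod K Cᵒᵖ) : Sub F where
  carrier Y := ⨆ (E : C) (_ : P E) (φ : rep K E ⟶ F), LinearMap.range (φ.hom.app Y).hom
  map_mem {Y Z} f x hx := by
    refine (show (⨆ (E : C) (_ : P E) (φ : rep K E ⟶ F), LinearMap.range (φ.hom.app Y).hom) ≤
      Submodule.comap (F.obj.map f).hom
        (⨆ (E : C) (_ : P E) (φ : rep K E ⟶ F), LinearMap.range (φ.hom.app Z).hom) from ?_) hx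
    refine iSup_le fun E => iSup_le fun hE => iSup_le fun φ => ?_
    rintro _ ⟨a, rfl⟩
    refine Submodule.mem_iSup_of_mem E (Submodule.mem_iSup_of_mem hE
      (Submodule.mem_iSup_of_mem φ ⟨((rep K E).obj.map f).hom a, ?_⟩))
    exact ConcreteCategory.congr_hom (φ.hom.naturality f) a

/-- The factor `F^{(i + 1)} / F^{(i)}` of the trace filtration of `F`. -/
def traceFactor (B : ℕ → ObjectProperty C) (i : ℕ) (F : LMod K Cᵒᵖ) : LMod K Cᵒᵖ :=
  ((trace (B i) F).restrict (trace (B (i + 1)) F)).quot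

/-- The class `F(Δ)` of modules with a `Δ`-filtration: every factor `F^{(i + 1)} / F^{(i)}` of the
trace filtration is a finite sum of modules in `Δ(i + 1)`. -/
def HasDeltaFiltration (B : ℕ → ObjectProperty C) (F : LMod K Cᵒᵖ) : Prop :=
  ∀ i, ∃ (n : ℕ) (E : Fin n → C), (∀ k, B (i + 1) (E k)) ∧
    Nonempty (traceFactor B i F ≅ ⨁ fun k => standard K B i (E k))

end QuasiHereditary

end

end QuasiHereditary

/-! Write `F^(i)` for the trace of `B i` in `F`. A module that vanishes on `B i` is annihilated by
`I_{B i}`, so by Yoneda the modules `C(-, X) / I_{B i}(-, X)` are projective relative to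
epimorphisms from such modules. Both halves rest on this.

Kernels of epimorphisms. Let `0 → F' → F → G → 0` be exact with `F`, `G` in `F(Δ)`. The map
`F^(i+1)/F^(i) → G^(i+1)/G^(i)` is surjective, and relative projectivity splits it. Since the
factors are generated by their values on `B (i + 1)`, the splitting gives exactness at the factor of
`F` (`traceFactorMap_exact`), and induction on `i` gives `F' ∩ F^(i) = F'^(i)`
(`mem_trace_succ_of_map_mem`). So the factor of `F'` is a direct summand of a finite sum of standard
modules. By the Krull–Schmidt property it is again such a sum
(`exists_iso_biproduct_standard_of_retract`).

Vanishing of Ext. It is proved for `C(-, X) / I_{B i}(-, X)` with `X` arbitrary, by induction along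
the sequences `0 → I_{B (i+1)}/I_{B i}(-, X) → C/I_{B i}(-, X) → C/I_{B (i+1)}(-, X) → 0`. By
heredity the left term is a summand of a finite sum of modules `C/I_{B i}(-, E)`, so it is acyclic
whenever these are. What remains is to extend morphisms to `∇` from the left term to the middle. As
long as `∇` vanishes on `B (i + 1)`, all these morphisms are zero
(`isExtAcyclic_standard_of_vanishing`). From `i = j` on, with `∇` attached to `B j`, they extend
because `∇` is injective relative to modules vanishing on `B j` (`isExtAcyclic_standard_of_le`). A
finite filtration carries the result to all of `F(Δ)`.

Vanishing of Tor. Linear forms on `F ⊗ M` are morphisms `F → DM`, so a nonzero class in `Tor_t(F,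
M)` would be detected by a class in `Ext^t(F, DM)`, which is zero. -/

namespace QuasiHereditary

noncomputable section

/-! ### Exactness of sequences of modules, tested on elements. -/

section Pointwise

variable {K : Type v} [Field K] {D : Type u} [Category.{v} D] [Preadditive D] [Linear K D]

theorem comp_app_apply
    {M N P : LMod K D} (f : M ⟶ N) (g : N ⟶ P) (X : D) (x : M.obj.obj X) :
    ((f ≫ g).hom.app X).hom x = (g.hom.app X).hom ((f.hom.app X).hom x) := rfl

theorem naturality_apply
    {M N : LMod K D} (f : M ⟶ N) {X Y : D} (a : X ⟶ Y) (x : M.obj.obj X) :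
    (f.hom.app Y).hom ((M.obj.map a).hom x) = (N.obj.map a).hom ((f.hom.app X).hom x) :=
  ConcreteCategory.congr_hom (f.hom.naturality a) x

theorem map_comp_apply
    (M : LMod K D) {X Y Z : D} (a : X ⟶ Y) (b : Y ⟶ Z) (x : M.obj.obj X) :
    (M.obj.map (a ≫ b)).hom x = (M.obj.map b).hom ((M.obj.map a).hom x) :=
  ConcreteCategory.congr_hom (M.obj.map_comp a b) x

theorem map_id_apply
    (M : LMod K D) (X : D) (x : M.obj.obj X) :
    (M.obj.map (𝟙 X)).hom x = x :=
  ConcreteCategory.congr_hom (M.obj.map_id X) x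

theorem lmod_hom_ext
    {M N : LMod K D} {f g : M ⟶ N}
    (h : ∀ X (x : M.obj.obj X), (f.hom.app X).hom x = (g.hom.app X).hom x) : f = g := by
  ext X x
  exact h X x

theorem repHom_comp {X : D} {M N : LMod K Dᵒᵖ} (x : M.obj.obj (op X)) (f : M ⟶ N) :
    repHom K x ≫ f = repHom K ((f.hom.app (op X)).hom x) := by
  refine rep_hom_ext K ((comp_app_apply (repHom K x) f _ _).trans ?_)
  exact (congrArg _ (repHom_id K x)).trans (repHom_id K _).symm

theorem repHom_zero {X : D} {M : LMod K Dᵒᵖ} :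
    repHom K (0 : M.obj.obj (op X)) = 0 := by
  refine rep_hom_ext K ?_
  rw [repHom_id]; rfl

theorem mono_iff_injective {M N : LMod K Dᵒᵖ} (f : M ⟶ N) :
    Mono f ↔ ∀ X, Function.Injective (f.hom.app X).hom := by
  constructor
  · intro _ X
    refine (injective_iff_map_eq_zero _).2 fun x hx => ?_
    have h : repHom K (X := unop X) x ≫ f = 0 := by rw [repHom_comp]; erw [hx]; exact repHom_zero
    have h0 := zero_of_comp_mono f h
    rw [← repHom_id K (X := unop X) x, h0]
    rfl
  · intro h
    refine ⟨fun a b hab => lmod_hom_ext fun X x => h X ?_⟩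
    rw [← comp_app_apply, hab, comp_app_apply]

/-- By Yoneda an element at `X` is a morphism from the representable module. Exactness lifts it
after an epimorphism onto that module, and a preimage of the identity of `X` gives the element
sought. -/
theorem exact_iff (S : ShortComplex (LMod K Dᵒᵖ)) :
    S.Exact ↔ ∀ X (x : S.X₂.obj.obj X), (S.g.hom.app X).hom x = 0 →
      ∃ y, (S.f.hom.app X).hom y = x := by
  constructor
  · intro hS X x hx
    have h : repHom K (X := unop X) x ≫ S.g = 0 := by
      rw [repHom_comp]; erw [hx]; exact repHom_zero
    obtain ⟨A, π, hπ, y, hy⟩ := S.exact_iff_exact_up_to_refinements.1 hS _ h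
    obtain ⟨z, hz⟩ := (epi_iff_surjective K π).1 hπ X (𝟙 (unop X))
    refine ⟨(y.hom.app X).hom z, ?_⟩
    rw [← comp_app_apply, ← hy, comp_app_apply, hz]
    exact repHom_id K (X := unop X) x
  · intro h
    rw [S.exact_iff_epi_kernel_lift, epi_iff_surjective]
    intro X y
    have hm := (mono_iff_injective (kernel.ι S.g)).1 inferInstance X
    obtain ⟨z, hz⟩ := h X (((kernel.ι S.g).hom.app X).hom y) (by
      rw [← comp_app_apply, kernel.condition]; rfl)
    refine ⟨z, hm ?_⟩
    rw [← comp_app_apply, kernel.lift_ι, hz]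

theorem shortExact_iff (S : ShortComplex (LMod K Dᵒᵖ)) :
    S.ShortExact ↔ (∀ X, Function.Injective (S.f.hom.app X).hom) ∧
      (∀ X (x : S.X₂.obj.obj X), (S.g.hom.app X).hom x = 0 → ∃ y, (S.f.hom.app X).hom y = x) ∧
      ∀ X, Function.Surjective (S.g.hom.app X).hom := by
  rw [← mono_iff_injective, ← exact_iff, ← epi_iff_surjective]
  exact ⟨fun h => ⟨h.mono_f, h.exact, h.epi_g⟩,
    fun ⟨h₁, h₂, h₃⟩ => { exact := h₂, mono_f := h₁, epi_g := h₃ }⟩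

theorem isIso_of_bijective {M N : LMod K Dᵒᵖ} (f : M ⟶ N)
    (h : ∀ X, Function.Bijective (f.hom.app X).hom) : IsIso f := by
  have := (mono_iff_injective f).2 fun X => (h X).1
  have := (epi_iff_surjective K f).2 fun X => (h X).2
  exact isIso_of_mono_of_epi f

end Pointwise

/-! ### Direct summands of sums of objects with local endomorphism rings. -/

section KrullSchmidt

variable {A : Type*} [Category* A] [Preadditive A]

/-- Jacobson's identity: if `c` inverts `1 - ab`, then `1 + bca` inverts `1 - ba`. -/
theorem isIso_one_sub_comp {X Y : A} (a : X ⟶ Y) (b : Y ⟶ X) (h : IsIso (𝟙 X - a ≫ b)) :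
    IsIso (𝟙 Y - b ≫ a) := by
  let c := inv (𝟙 X - a ≫ b)
  have h₁ : c - a ≫ b ≫ c = 𝟙 X := by
    have := IsIso.hom_inv_id (𝟙 X - a ≫ b)
    rwa [Preadditive.sub_comp, Category.id_comp, Category.assoc] at this
  have h₂ : c - c ≫ a ≫ b = 𝟙 X := by
    have := IsIso.inv_hom_id (𝟙 X - a ≫ b)
    rwa [Preadditive.comp_sub, Category.comp_id] at this
  refine ⟨𝟙 Y + b ≫ c ≫ a, ?_, ?_⟩
  · calc (𝟙 Y - b ≫ a) ≫ (𝟙 Y + b ≫ c ≫ a)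
        = 𝟙 Y - b ≫ a + b ≫ (c - a ≫ b ≫ c) ≫ a := by
          simp only [Preadditive.sub_comp, Preadditive.comp_add, Preadditive.comp_sub,
            Category.assoc, Category.id_comp, Category.comp_id]
      _ = 𝟙 Y := by rw [h₁]; simp
  · calc (𝟙 Y + b ≫ c ≫ a) ≫ (𝟙 Y - b ≫ a)
        = 𝟙 Y - b ≫ a + b ≫ (c - c ≫ a ≫ b) ≫ a := by
          simp only [Preadditive.sub_comp, Preadditive.add_comp, Preadditive.comp_sub,
            Category.assoc, Category.id_comp, Category.comp_id]
          abel
      _ = 𝟙 Y := by rw [h₂]; simp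

/-- A retract of a finite direct sum of objects with local (or zero) endomorphism rings is the
direct sum of some of these objects. -/
theorem exists_decomposition_of_sum_eq_id [HasKernels A] {ι : Type} (X : ι → A)
    (hX : ∀ k (a : X k ⟶ X k), IsIso a ∨ IsIso (𝟙 _ - a)) (s : Finset ι) :
    ∀ (M : A) (p : ∀ k, M ⟶ X k) (q : ∀ k, X k ⟶ M), ∑ k ∈ s, p k ≫ q k = 𝟙 M →
      ∃ (J : Type) (_ : Fintype J) (_ : DecidableEq J) (σ : J → ι) (i : ∀ j, X (σ j) ⟶ M)
        (r : ∀ j, M ⟶ X (σ j)), (∀ j, i j ≫ r j = 𝟙 _) ∧ (∀ j l, j ≠ l → i j ≫ r l = 0) ∧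
          ∑ j, r j ≫ i j = 𝟙 M := by
  classical
  induction s using Finset.induction_on with
  | empty =>
    intro M p q h
    exact ⟨Empty, inferInstance, inferInstance, Empty.elim, fun j => j.elim, fun j => j.elim,
      fun j => j.elim, fun j => j.elim, by simpa using h⟩
  | insert a s ha ih =>
    intro M p q h
    rw [Finset.sum_insert ha] at h
    have hs : ∑ k ∈ s, p k ≫ q k = 𝟙 M - p a ≫ q a := by rw [← h]; abel
    obtain hu | hu := hX a (q a ≫ p a)
    -- Here `X a` is a direct summand of `M` with complement the kernel of `p a`. Since `q a ≫ e =
    -- 0`, the term at `a` drops out and induction applies to the kernel.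
    · let c := inv (q a ≫ p a)
      have hc : q a ≫ p a ≫ c = 𝟙 _ := by
        rw [← Category.assoc, IsIso.hom_inv_id (q a ≫ p a)]
      have hc' : c ≫ q a ≫ p a = 𝟙 _ := IsIso.inv_hom_id (q a ≫ p a)
      let m : kernel (p a) ⟶ M := kernel.ι (p a)
      have hm : m ≫ p a = 0 := kernel.condition _
      let e : M ⟶ kernel (p a) := kernel.lift (p a) (𝟙 M - p a ≫ c ≫ q a) (by
        rw [Preadditive.sub_comp, Category.assoc, Category.assoc, hc']
        simp)
      have he : e ≫ m = 𝟙 M - p a ≫ c ≫ q a := kernel.lift_ι _ _ _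
      have hme : m ≫ e = 𝟙 _ := by
        rw [← cancel_mono m, Category.assoc, he, Preadditive.comp_sub, ← Category.assoc m (p a), hm]
        simp
      have hqe : q a ≫ e = 0 := by
        rw [← cancel_mono m, Category.assoc, he, Preadditive.comp_sub]
        have : q a ≫ p a ≫ c ≫ q a = q a := by
          rw [← Category.assoc (p a), ← Category.assoc, hc, Category.id_comp]
        rw [this]; simp
      obtain ⟨J, _, _, σ, i, r, h₁, h₂, h₃⟩ := ih (kernel (p a)) (fun k => m ≫ p k)
        (fun k => q k ≫ e) (by
          have : ∑ k ∈ s, (m ≫ p k) ≫ q k ≫ e = m ≫ (∑ k ∈ s, p k ≫ q k) ≫ e := by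
            simp [Preadditive.sum_comp, Preadditive.comp_sum]
          rw [this, hs]
          simp [hqe, hme])
      refine ⟨Option J, inferInstance, inferInstance, fun o => o.elim a σ,
        fun o => match o with
          | none => q a
          | some j => i j ≫ m,
        fun o => match o with
          | none => p a ≫ c
          | some j => e ≫ r j, ?_, ?_, ?_⟩
      · rintro (_ | j)
        · exact hc
        · change (i j ≫ m) ≫ e ≫ r j = 𝟙 _
          rw [Category.assoc, ← Category.assoc m, hme, Category.id_comp, h₁]
      · rintro (_ | j) (_ | l) hjl
        · exact (hjl rfl).elim
        · change q a ≫ e ≫ r l = 0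
          rw [← Category.assoc, hqe, zero_comp]
        · change (i j ≫ m) ≫ p a ≫ c = 0
          rw [Category.assoc, ← Category.assoc m, hm, zero_comp, comp_zero]
        · change (i j ≫ m) ≫ e ≫ r l = 0
          rw [Category.assoc, ← Category.assoc m, hme, Category.id_comp]
          exact h₂ j l fun h => hjl (by rw [h])
      · rw [Fintype.sum_option]
        change (p a ≫ c) ≫ q a + ∑ j, (e ≫ r j) ≫ i j ≫ m = 𝟙 M
        have : ∑ j, (e ≫ r j) ≫ i j ≫ m = e ≫ (∑ j, r j ≫ i j) ≫ m := by
          simp [Preadditive.sum_comp, Preadditive.comp_sum]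
        rw [this, h₃, Category.id_comp, he, Category.assoc]
        abel
    -- Here the sum over `s` alone is an automorphism of `M`; composing with its inverse removes the
    -- index `a`.
    · have hu' := isIso_one_sub_comp _ _ hu
      refine ih M (fun k => inv (𝟙 M - p a ≫ q a) ≫ p k) q ?_
      have : ∑ k ∈ s, (inv (𝟙 M - p a ≫ q a) ≫ p k) ≫ q k =
          inv (𝟙 M - p a ≫ q a) ≫ ∑ k ∈ s, p k ≫ q k := by
        simp [Preadditive.comp_sum]
      rw [this, hs, IsIso.inv_hom_id]

theorem exists_iso_biproduct_of_sum_eq_id [HasKernels A] [HasFiniteBiproducts A] {ι : Type} [Fintype ι]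
    (X : ι → A) (hX : ∀ k (a : X k ⟶ X k), IsIso a ∨ IsIso (𝟙 _ - a)) {M : A}
    (p : ∀ k, M ⟶ X k) (q : ∀ k, X k ⟶ M) (h : ∑ k, p k ≫ q k = 𝟙 M) :
    ∃ (n : ℕ) (σ : Fin n → ι), Nonempty (M ≅ ⨁ fun k => X (σ k)) := by
  obtain ⟨J, _, _, σ, i, r, h₁, h₂, h₃⟩ := exists_decomposition_of_sum_eq_id X hX Finset.univ M p q h
  let e := Fintype.equivFin J
  refine ⟨Fintype.card J, fun k => σ (e.symm k), ⟨⟨biproduct.lift fun k => r (e.symm k),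
    biproduct.desc fun k => i (e.symm k), ?_, ?_⟩⟩⟩
  · rw [biproduct.lift_desc, ← h₃]
    exact e.symm.sum_comp fun j => r j ≫ i j
  · refine biproduct.hom_ext' _ _ fun k => biproduct.hom_ext _ _ fun l => ?_
    simp only [biproduct.ι_desc_assoc, Category.assoc, biproduct.lift_π, Category.comp_id]
    by_cases hkl : k = l
    · subst hkl
      rw [h₁, biproduct.ι_π_self]
    · rw [biproduct.ι_π_ne _ hkl, h₂ _ _ fun h => hkl (e.symm.injective h)]

end KrullSchmidt

/-! ### Submodules, quotients, and the modules `D(-, X) / I(-, X)`. -/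

section Subquotients

variable {K : Type v} [Field K] {D : Type u} [Category.{v} D] [Preadditive D] [Linear K D]

namespace Sub

variable {M : LMod K D} (N : Sub M)

/-- The inclusion of a submodule. -/
def incl : N.toLMod ⟶ M :=
  ObjectProperty.homMk { app := fun X => ModuleCat.ofHom (N.carrier X).subtype }

/-- The projection onto a quotient module. -/
def proj : M ⟶ N.quot :=
  ObjectProperty.homMk { app := fun X => ModuleCat.ofHom (N.carrier X).mkQ }

theorem incl_injective (X : D) : Function.Injective (N.incl.hom.app X).hom :=
  Subtype.val_injective

theorem incl_mem (X : D) (x : N.toLMod.obj.obj X) : (N.incl.hom.app X).hom x ∈ N.carrier X :=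
  x.2

theorem exists_incl_eq {X : D} {x : M.obj.obj X} (hx : x ∈ N.carrier X) :
    ∃ y, (N.incl.hom.app X).hom y = x := ⟨⟨x, hx⟩, rfl⟩

theorem proj_surjective (X : D) : Function.Surjective (N.proj.hom.app X).hom :=
  Submodule.mkQ_surjective _

theorem proj_eq_zero_iff {X : D} (x : M.obj.obj X) :
    (N.proj.hom.app X).hom x = 0 ↔ x ∈ N.carrier X :=
  Submodule.Quotient.mk_eq_zero _

/-- A morphism that vanishes on a submodule factors through the quotient. -/
def desc {P : LMod K D} (f : M ⟶ P) (h : ∀ X, ∀ x ∈ N.carrier X, (f.hom.app X).hom x = 0) :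
    N.quot ⟶ P :=
  ObjectProperty.homMk
    { app := fun X => ModuleCat.ofHom ((N.carrier X).liftQ (f.hom.app X).hom (h X))
      naturality := fun X Y a => by
        ext x
        obtain ⟨x, rfl⟩ := Submodule.Quotient.mk_surjective _ x
        exact naturality_apply f a x }

/-- A morphism with values in a submodule factors through the submodule. -/
def lift {P : LMod K D} (f : P ⟶ M) (h : ∀ X x, (f.hom.app X).hom x ∈ N.carrier X) :
    P ⟶ N.toLMod :=
  ObjectProperty.homMk
    { app := fun X => ModuleCat.ofHom ((f.hom.app X).hom.codRestrict (N.carrier X) (h X))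
      naturality := fun X Y a => by
        ext x
        exact Subtype.ext (naturality_apply f a x) }

theorem lift_incl {P : LMod K D} (f : P ⟶ M) (h : ∀ X x, (f.hom.app X).hom x ∈ N.carrier X) :
    N.lift f h ≫ N.incl = f := rfl

/-- The preimage of a submodule under a morphism. -/
def comap {P : LMod K D} (f : P ⟶ M) : Sub P where
  carrier X := (N.carrier X).comap (f.hom.app X).hom
  map_mem a x hx := by
    rw [Submodule.mem_comap, naturality_apply]
    exact N.map_mem a _ hx

/-- The image of a submodule under a morphism. -/
def map {P : LMod K D} (f : M ⟶ P) : Sub P where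
  carrier X := (N.carrier X).map (f.hom.app X).hom
  map_mem a x hx := by
    obtain ⟨y, hy, rfl⟩ := hx
    exact ⟨_, N.map_mem a y hy, naturality_apply f a y⟩

end Sub

/-- The image of a morphism. -/
def rangeSub {M P : LMod K D} (f : M ⟶ P) : Sub P where
  carrier X := LinearMap.range (f.hom.app X).hom
  map_mem a x hx := by
    obtain ⟨y, rfl⟩ := hx
    exact ⟨_, naturality_apply f a y⟩

namespace CatIdeal

variable (I : CatIdeal K D)

/-- The generator of the module `D(-, X) / I(-, X)`. -/
def gen (X : D) : (I.row X).quot.obj.obj (op X) :=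
  ((I.row X).proj.hom.app (op X)).hom (𝟙 X)

theorem proj_eq_map_gen {X : D} (Y : Dᵒᵖ) (a : unop Y ⟶ X) :
    ((I.row X).proj.hom.app Y).hom a = ((I.row X).quot.obj.map a.op).hom (I.gen X) := by
  refine Eq.trans ?_ (naturality_apply (I.row X).proj a.op (𝟙 X))
  exact congrArg ((I.row X).proj.hom.app Y).hom (Category.comp_id a).symm

theorem rowQuot_hom_ext {X : D} {M : LMod K Dᵒᵖ} {f g : (I.row X).quot ⟶ M}
    (h : (f.hom.app (op X)).hom (I.gen X) = (g.hom.app (op X)).hom (I.gen X)) : f = g := by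
  refine lmod_hom_ext fun Y y => ?_
  obtain ⟨a, rfl⟩ := (I.row X).proj_surjective Y y
  have := I.proj_eq_map_gen Y a
  rw [this, naturality_apply, naturality_apply, h]

/-- The morphism from `D(-, X) / I(-, X)` given by an element annihilated by `I`. -/
def rowQuotLift {X : D} {M : LMod K Dᵒᵖ} (x : M.obj.obj (op X))
    (h : ∀ (Y : D), ∀ a ∈ I.carrier Y X, (M.obj.map a.op).hom x = 0) : (I.row X).quot ⟶ M :=
  (I.row X).desc (repHom K x) fun Y a ha => h (unop Y) a ha

theorem rowQuotLift_gen {X : D} {M : LMod K Dᵒᵖ} (x : M.obj.obj (op X))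
    (h : ∀ (Y : D), ∀ a ∈ I.carrier Y X, (M.obj.map a.op).hom x = 0) :
    ((I.rowQuotLift x h).hom.app (op X)).hom (I.gen X) = x :=
  repHom_id K x

theorem map_gen_eq_zero {X : D} {Y : D} {a : Y ⟶ X} (ha : a ∈ I.carrier Y X) :
    ((I.row X).quot.obj.map a.op).hom (I.gen X) = 0 := by
  rw [← I.proj_eq_map_gen (op Y) a]
  exact ((I.row X).proj_eq_zero_iff _).2 ha

theorem map_map_gen_eq_zero {X Y Z : D} (f : X ⟶ Y) {a : Z ⟶ X} (ha : a ∈ I.carrier Z X) :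
    ((I.row Y).quot.obj.map a.op).hom (((I.row Y).quot.obj.map f.op).hom (I.gen Y)) = 0 := by
  rw [← map_comp_apply]
  exact I.map_gen_eq_zero (I.comp_mem_right a f ha)

/-- The functor `X ↦ D(-, X) / I(-, X)`. -/
def rowQuotFunctor : D ⥤ LMod K Dᵒᵖ where
  obj X := (I.row X).quot
  map {X Y} f := I.rowQuotLift (((I.row Y).quot.obj.map f.op).hom (I.gen Y))
    fun _ _ ha => I.map_map_gen_eq_zero f ha
  map_id X := I.rowQuot_hom_ext <| (I.rowQuotLift_gen _ _).trans (map_id_apply _ _ _)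
  map_comp {X Y Z} f g := I.rowQuot_hom_ext <| (I.rowQuotLift_gen _ _).trans <| by
    rw [comp_app_apply]
    refine Eq.trans ?_ (congrArg _ (I.rowQuotLift_gen _ _).symm)
    rw [naturality_apply]
    refine Eq.trans ?_ (congrArg _ (I.rowQuotLift_gen _ _).symm)
    exact map_comp_apply _ _ _ _

theorem rowQuotFunctor_map_gen {X Y : D} (f : X ⟶ Y) :
    ((I.rowQuotFunctor.map f).hom.app (op X)).hom (I.gen X) =
      ((I.row Y).quot.obj.map f.op).hom (I.gen Y) :=
  I.rowQuotLift_gen _ fun _ _ ha => I.map_map_gen_eq_zero f ha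

instance : I.rowQuotFunctor.Additive where
  map_add {X Y f g} := I.rowQuot_hom_ext <| (I.rowQuotFunctor_map_gen _).trans <| by
    have h : (f + g).op = f.op + g.op := rfl
    rw [h, Functor.map_add]
    exact congrArg₂ (· + ·) (I.rowQuotFunctor_map_gen f).symm (I.rowQuotFunctor_map_gen g).symm

/-- Yoneda modulo `I`: a morphism is given by the image of the generator, which is the class of some
`f`. Hence the endomorphism ring of `D(-, X) / I(-, X)` is a quotient of that of `X`, so local or
zero if the latter is local. -/
instance : I.rowQuotFunctor.Full where
  map_surjective {X Y} φ := by
    obtain ⟨f, hf⟩ := (I.row Y).proj_surjective (op X) ((φ.hom.app (op X)).hom (I.gen X))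
    refine ⟨f, I.rowQuot_hom_ext ((I.rowQuotFunctor_map_gen f).trans ?_)⟩
    rw [← I.proj_eq_map_gen (op X) f]
    exact hf

end CatIdeal

/-- The action of a morphism through `E` in `P` passes through `M E = 0`; so `M` is in effect a
module over `D / I_P`. -/
theorem map_eq_zero_of_mem_factorIdeal {P : ObjectProperty D} {M : LMod K Dᵒᵖ}
    (hM : ∀ E, P E → ∀ x : M.obj.obj (op E), x = 0) {X Y : D} {a : Y ⟶ X}
    (ha : a ∈ (factorIdeal K P).carrier Y X) (x : M.obj.obj (op X)) :
    (M.obj.map a.op).hom x = 0 := by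
  refine Submodule.span_induction (p := fun a _ => (M.obj.map a.op).hom x = 0)
    ?_ ?_ ?_ ?_ ha
  · rintro _ ⟨E, g, h, hE, rfl⟩
    rw [op_comp, map_comp_apply, hM E hE ((M.obj.map h.op).hom x), map_zero]
  · rw [op_zero, Functor.map_zero]; rfl
  · intro a b _ _ ha hb
    rw [op_add, Functor.map_add, ModuleCat.hom_add, LinearMap.add_apply, ha, hb, add_zero]
  · intro r a _ ha
    have : (r • a).op = r • a.op := rfl
    rw [this, Functor.map_smul, ModuleCat.hom_smul, LinearMap.smul_apply, ha, smul_zero]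

theorem rowQuot_eq_zero {P : ObjectProperty D} (X : D) {E : D} (hE : P E)
    (x : ((factorIdeal K P).row X).quot.obj.obj (op E)) : x = 0 := by
  obtain ⟨a, rfl⟩ := ((factorIdeal K P).row X).proj_surjective _ x
  refine (((factorIdeal K P).row X).proj_eq_zero_iff a).2
    (show (show E ⟶ X from a) ∈ (factorIdeal K P).carrier E X from ?_)
  exact Submodule.subset_span ⟨E, 𝟙 E, _, hE, (Category.id_comp (show E ⟶ X from a)).symm⟩

/-- The modules `D(-, X) / I_P(-, X)` are projective relative to epimorphisms from modules that
vanish on `P`. -/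
theorem exists_rowQuot_lift {P : ObjectProperty D} {M N : LMod K Dᵒᵖ}
    (hM : ∀ E, P E → ∀ x : M.obj.obj (op E), x = 0) (p : M ⟶ N)
    (hp : ∀ X, Function.Surjective (p.hom.app X).hom) {X : D}
    (f : ((factorIdeal K P).row X).quot ⟶ N) : ∃ g, g ≫ p = f := by
  obtain ⟨x, hx⟩ := hp (op X) ((f.hom.app (op X)).hom (CatIdeal.gen _ X))
  refine ⟨CatIdeal.rowQuotLift _ x fun Y a ha => map_eq_zero_of_mem_factorIdeal hM ha x,
    CatIdeal.rowQuot_hom_ext _ ?_⟩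
  rw [comp_app_apply]
  exact (congrArg _ (CatIdeal.rowQuotLift_gen _ _ _)).trans hx

end Subquotients

/-! ### The trace filtration and its factors. -/

section Trace

variable {K : Type v} [Field K] {C : Type u} [Category.{v} C] [Preadditive C] [Linear K C]

theorem mem_trace {P : ObjectProperty C} (F : LMod K Cᵒᵖ) {E : C} (hE : P E)
    (x : F.obj.obj (op E)) : x ∈ (trace P F).carrier (op E) := by
  refine Submodule.mem_iSup_of_mem E (Submodule.mem_iSup_of_mem hE
    (Submodule.mem_iSup_of_mem (repHom K x) ?_))
  exact ⟨𝟙 E, repHom_id K x⟩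

/-- The trace is the smallest submodule that contains all values at objects satisfying `P`. -/
theorem trace_le {P : ObjectProperty C} {F : LMod K Cᵒᵖ} (N : Sub F)
    (h : ∀ E, P E → ∀ x, x ∈ N.carrier (op E)) (Y : Cᵒᵖ) :
    (trace P F).carrier Y ≤ N.carrier Y := by
  refine iSup_le fun E => iSup_le fun hE => iSup_le fun φ => ?_
  rintro _ ⟨a, rfl⟩
  have : (φ.hom.app Y).hom a = (F.obj.map (show unop Y ⟶ E from a).op).hom
      ((φ.hom.app (op E)).hom (𝟙 E)) := by
    refine Eq.trans ?_ (naturality_apply φ (show unop Y ⟶ E from a).op (𝟙 E))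
    exact congrArg (φ.hom.app Y).hom (Category.comp_id (show unop Y ⟶ E from a)).symm
  rw [this]
  exact N.map_mem _ _ (h E hE _)

theorem trace_mono {P Q : ObjectProperty C} (h : P ≤ Q) (F : LMod K Cᵒᵖ) (Y : Cᵒᵖ) :
    (trace P F).carrier Y ≤ (trace Q F).carrier Y :=
  trace_le _ (fun E hE x => mem_trace F (h E hE) x) Y

theorem map_mem_trace (P : ObjectProperty C) {F G : LMod K Cᵒᵖ} (f : F ⟶ G) {Y : Cᵒᵖ}
    {x : F.obj.obj Y} (hx : x ∈ (trace P F).carrier Y) :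
    (f.hom.app Y).hom x ∈ (trace P G).carrier Y :=
  trace_le ((trace P G).comap f) (fun _ hE _ => mem_trace G hE _) Y hx

theorem exists_mem_trace_of_surjective (P : ObjectProperty C) {F G : LMod K Cᵒᵖ} (f : F ⟶ G)
    (hf : ∀ Y, Function.Surjective (f.hom.app Y).hom) {Y : Cᵒᵖ}
    {y : G.obj.obj Y} (hy : y ∈ (trace P G).carrier Y) :
    ∃ x ∈ (trace P F).carrier Y, (f.hom.app Y).hom x = y := by
  refine trace_le ((trace P F).map f) (fun E hE y => ?_) Y hy
  obtain ⟨x, rfl⟩ := hf _ y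
  exact ⟨x, mem_trace F hE x, rfl⟩

theorem isZero_eval {E : C} (hE : IsZero E) (F : LMod K Cᵒᵖ) (x : F.obj.obj (op E)) : x = 0 := by
  have h : (𝟙 (op E) : op E ⟶ op E) = 0 := (IsZero.op hE).eq_of_src _ _
  rw [← map_id_apply F (op E) x, h, Functor.map_zero]
  rfl

theorem trace_isZero_eq_zero {P : ObjectProperty C} (hP : ∀ X, P X → IsZero X) {F : LMod K Cᵒᵖ}
    {Y : Cᵒᵖ} {x : F.obj.obj Y} (hx : x ∈ (trace P F).carrier Y) : x = 0 :=
  trace_le ⟨fun _ => ⊥, fun f x hx => by rw [(Submodule.mem_bot K).1 hx, map_zero]; exact rfl⟩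
    (fun E hE x => isZero_eval (hP E hE) F x) Y hx

variable {B : ℕ → ObjectProperty C}

/-- The map from the trace to the factor of the trace filtration. -/
def traceProj (B : ℕ → ObjectProperty C) (i : ℕ) (F : LMod K Cᵒᵖ) :
    (trace (B (i + 1)) F).toLMod ⟶ traceFactor B i F :=
  Sub.proj _

/-- The class in the factor of the trace filtration of an element of the trace. -/
def traceMk (B : ℕ → ObjectProperty C) (i : ℕ) {F : LMod K Cᵒᵖ} {Y : Cᵒᵖ} (x : F.obj.obj Y)
    (hx : x ∈ (trace (B (i + 1)) F).carrier Y) : (traceFactor B i F).obj.obj Y :=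
  ((traceProj B i F).hom.app Y).hom ⟨x, hx⟩

theorem traceMk_surjective (i : ℕ) {F : LMod K Cᵒᵖ} {Y : Cᵒᵖ} (z : (traceFactor B i F).obj.obj Y) :
    ∃ x hx, traceMk B i (F := F) x hx = z := by
  obtain ⟨⟨x, hx⟩, h⟩ := Sub.proj_surjective _ Y z
  exact ⟨x, hx, h⟩

theorem traceMk_eq_zero_iff (i : ℕ) {F : LMod K Cᵒᵖ} {Y : Cᵒᵖ} {x : F.obj.obj Y}
    (hx : x ∈ (trace (B (i + 1)) F).carrier Y) :
    traceMk B i x hx = 0 ↔ x ∈ (trace (B i) F).carrier Y :=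
  Sub.proj_eq_zero_iff _ _

theorem traceMk_sub (i : ℕ) {F : LMod K Cᵒᵖ} {Y : Cᵒᵖ} {x y : F.obj.obj Y}
    (hx : x ∈ (trace (B (i + 1)) F).carrier Y) (hy : y ∈ (trace (B (i + 1)) F).carrier Y) :
    traceMk B i x hx - traceMk B i y hy = traceMk B i (x - y) (Submodule.sub_mem _ hx hy) := rfl

/-- The map induced on the factors of the trace filtrations. -/
def traceFactorMap (B : ℕ → ObjectProperty C) (i : ℕ) {F G : LMod K Cᵒᵖ} (f : F ⟶ G) :
    traceFactor B i F ⟶ traceFactor B i G :=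
  Sub.desc _ ((trace (B (i + 1)) G).lift ((trace (B (i + 1)) F).incl ≫ f)
      (fun _ x => map_mem_trace _ f x.2) ≫ traceProj B i G)
    fun _ x hx => (traceMk_eq_zero_iff i (map_mem_trace _ f x.2)).2 (map_mem_trace _ f hx)

theorem traceFactorMap_traceMk (i : ℕ) {F G : LMod K Cᵒᵖ} (f : F ⟶ G) {Y : Cᵒᵖ}
    {x : F.obj.obj Y} (hx : x ∈ (trace (B (i + 1)) F).carrier Y) :
    ((traceFactorMap B i f).hom.app Y).hom (traceMk B i x hx) =
      traceMk B i ((f.hom.app Y).hom x) (map_mem_trace _ f hx) := rfl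

theorem traceFactor_eq_zero (i : ℕ) {F : LMod K Cᵒᵖ} {E : C} (hE : B i E)
    (z : (traceFactor B i F).obj.obj (op E)) : z = 0 := by
  obtain ⟨x, hx, rfl⟩ := traceMk_surjective i z
  exact (traceMk_eq_zero_iff i hx).2 (mem_trace F hE x)

/-- The factor inherits from the trace that it is generated by its values on `B (i + 1)`: pull `N`
back to a submodule of `F` and use minimality of the trace. -/
theorem traceFactor_le (i : ℕ) {F : LMod K Cᵒᵖ} (N : Sub (traceFactor B i F))
    (h : ∀ E, B (i + 1) E → ∀ x, x ∈ N.carrier (op E)) (Y : Cᵒᵖ)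
    (z : (traceFactor B i F).obj.obj Y) : z ∈ N.carrier Y := by
  obtain ⟨x, hx, rfl⟩ := traceMk_surjective i z
  let N' : Sub F :=
    { carrier := fun Y => ((N.carrier Y).comap ((traceProj B i F).hom.app Y).hom).map
        ((trace (B (i + 1)) F).carrier Y).subtype
      map_mem := by
        rintro X Y a _ ⟨y, hy, rfl⟩
        refine ⟨⟨_, (trace (B (i + 1)) F).map_mem a y.1 y.2⟩, ?_, rfl⟩
        exact N.map_mem a _ hy }
  obtain ⟨y, hy, rfl⟩ := trace_le N' (fun E hE x => ⟨⟨x, mem_trace F hE x⟩, h E hE _, rfl⟩) Y hx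
  exact hy

end Trace

/-! ### Closure of `F(Δ)` under kernels of epimorphisms. -/

section KernelsOfEpimorphisms

variable {K : Type v} [Field K] {C : Type u} [Category.{v} C] [Preadditive C] [Linear K C]
  {B : ℕ → ObjectProperty C}

theorem exists_section_of_iso_biproduct_standard {i : ℕ} {M N : LMod K Cᵒᵖ}
    (hM : ∀ E, B i E → ∀ x : M.obj.obj (op E), x = 0) (p : M ⟶ N)
    (hp : ∀ X, Function.Surjective (p.hom.app X).hom) {n : ℕ} {E : Fin n → C}
    (e : N ≅ ⨁ fun k => standard K B i (E k)) : ∃ s, s ≫ p = 𝟙 N := by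
  have hk : ∀ k, ∃ g : standard K B i (E k) ⟶ M,
      g ≫ p = biproduct.ι (fun k => standard K B i (E k)) k ≫ e.inv :=
    fun k => exists_rowQuot_lift hM p hp _
  choose g hg using hk
  refine ⟨e.hom ≫ biproduct.desc g, ?_⟩
  have : biproduct.desc g ≫ p = e.inv := by
    refine biproduct.hom_ext' _ _ fun k => ?_
    rw [biproduct.ι_desc_assoc]
    exact hg k
  rw [Category.assoc, this, e.hom_inv_id]

variable {F' F G : LMod K Cᵒᵖ} {f : F' ⟶ F} {g : F ⟶ G}

theorem traceFactorMap_surjective (i : ℕ) (hg : ∀ X, Function.Surjective (g.hom.app X).hom)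
    (X : Cᵒᵖ) : Function.Surjective ((traceFactorMap B i g).hom.app X).hom := by
  intro z
  obtain ⟨y, hy, rfl⟩ := traceMk_surjective i z
  obtain ⟨x, hx, rfl⟩ := exists_mem_trace_of_surjective _ g hg hy
  exact ⟨traceMk B i x hx, rfl⟩

theorem traceFactorMap_injective (i : ℕ)
    (h : ∀ Y x, (f.hom.app Y).hom x ∈ (trace (B i) F).carrier Y → x ∈ (trace (B i) F').carrier Y)
    (X : Cᵒᵖ) : Function.Injective ((traceFactorMap B i f).hom.app X).hom := by
  refine (injective_iff_map_eq_zero _).2 fun z hz => ?_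
  obtain ⟨x, hx, rfl⟩ := traceMk_surjective i z
  exact (traceMk_eq_zero_iff i hx).2 (h X x ((traceMk_eq_zero_iff i _).1 hz))

/-- If the factor of `G` is a sum of standard modules, then the sequence of the factors of the
trace filtrations is exact in the middle. -/
theorem traceFactorMap_exact (i : ℕ)
    (hex : ∀ X (x : F.obj.obj X), (g.hom.app X).hom x = 0 → ∃ y, (f.hom.app X).hom y = x)
    (hg : ∀ X, Function.Surjective (g.hom.app X).hom)
    {s : traceFactor B i G ⟶ traceFactor B i F} (hs : s ≫ traceFactorMap B i g = 𝟙 _)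
    (X : Cᵒᵖ) (z : (traceFactor B i F).obj.obj X)
    (hz : ((traceFactorMap B i g).hom.app X).hom z = 0) :
    ∃ y, ((traceFactorMap B i f).hom.app X).hom y = z := by
  -- The section yields a projector onto the kernel. It makes the claim a statement about all
  -- elements of the factor, which may then be checked at objects of `B (i + 1)`, where the trace is
  -- everything.
  let ρ : traceFactor B i F ⟶ traceFactor B i F := 𝟙 _ - traceFactorMap B i g ≫ s
  have hρ : ρ ≫ traceFactorMap B i g = 0 := by
    rw [Preadditive.sub_comp, Category.assoc, hs, Category.id_comp, Category.comp_id, sub_self]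
  have hρz : (ρ.hom.app X).hom z = z := by
    change z - (s.hom.app X).hom (((traceFactorMap B i g).hom.app X).hom z) = z
    rw [hz, map_zero, sub_zero]
  have key : z ∈ ((rangeSub (traceFactorMap B i f)).comap ρ).carrier X := by
    refine traceFactor_le i _ (fun E hE z => ?_) X z
    have h0 : ((traceFactorMap B i g).hom.app (op E)).hom ((ρ.hom.app (op E)).hom z) = 0 := by
      rw [← comp_app_apply, hρ]; rfl
    obtain ⟨w, hw, hwz⟩ := traceMk_surjective i ((ρ.hom.app (op E)).hom z)
    rw [← hwz, traceFactorMap_traceMk, traceMk_eq_zero_iff] at h0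
    -- Only the class of `g w` is zero; `w'` in `F^(i)` corrects the representative so that `w - w'`
    -- lies in the kernel of `g`.
    obtain ⟨w', hw', hww⟩ := exists_mem_trace_of_surjective _ g hg h0
    obtain ⟨x, hx⟩ := hex _ (w - w') (by rw [map_sub, hww, sub_self])
    refine ⟨traceMk B i x (mem_trace F' hE x), ?_⟩
    rw [← hwz, ← sub_eq_zero, traceFactorMap_traceMk, traceMk_sub, traceMk_eq_zero_iff, hx]
    rw [sub_sub_cancel_left]
    exact Submodule.neg_mem _ hw'
  obtain ⟨y, hy⟩ := key
  exact ⟨y, hy.trans hρz⟩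

/-- Inductive step for `F' ∩ F^(i) = F'^(i)`. The class of `f x` dies in the factor of `G`, so it
comes from some `x'` in `F'^(i+1)`. Then `f (x' - x)` lies in `F^(i)`, and `h` puts `x' - x` in
`F'^(i)`. -/
theorem mem_trace_succ_of_map_mem (hB : Monotone B) (i : ℕ) (hfg : f ≫ g = 0)
    (hex : ∀ X (x : F.obj.obj X), (g.hom.app X).hom x = 0 → ∃ y, (f.hom.app X).hom y = x)
    (hg : ∀ X, Function.Surjective (g.hom.app X).hom)
    {s : traceFactor B i G ⟶ traceFactor B i F} (hs : s ≫ traceFactorMap B i g = 𝟙 _)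
    (h : ∀ Y x, (f.hom.app Y).hom x ∈ (trace (B i) F).carrier Y → x ∈ (trace (B i) F').carrier Y)
    (Y : Cᵒᵖ) (x : F'.obj.obj Y) (hx : (f.hom.app Y).hom x ∈ (trace (B (i + 1)) F).carrier Y) :
    x ∈ (trace (B (i + 1)) F').carrier Y := by
  obtain ⟨y, hy⟩ := traceFactorMap_exact i hex hg hs Y (traceMk B i _ hx) (by
    rw [traceFactorMap_traceMk, traceMk_eq_zero_iff, ← comp_app_apply, hfg]
    exact Submodule.zero_mem _)
  obtain ⟨x', hx', rfl⟩ := traceMk_surjective i y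
  rw [← sub_eq_zero, traceFactorMap_traceMk, traceMk_sub, traceMk_eq_zero_iff, ← map_sub] at hy
  have := trace_mono (hB (Nat.le_succ i)) F' Y (h Y _ hy)
  have h3 := Submodule.sub_mem _ hx' this
  rwa [sub_sub_cancel] at h3

variable [HasFiniteBiproducts C]

/-- The class of finite sums of objects `Φ E` with `E` in `P` is closed under direct summands when
`Φ` is full, its source is Krull-Schmidt and `P` is closed under direct summands. -/
theorem exists_iso_biproduct_map_of_retract (hKS : IsKrullSchmidt C) {A : Type*} [Category* A]
    [Preadditive A] [HasKernels A] [HasFiniteBiproducts A] (Φ : C ⥤ A) [Φ.Additive] [Φ.Full]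
    {P : ObjectProperty C} [P.IsStableUnderRetracts] {n : ℕ} {E : Fin n → C}
    (hE : ∀ k, P (E k)) {M : A} (s : M ⟶ ⨁ fun k => Φ.obj (E k))
    (r : (⨁ fun k => Φ.obj (E k)) ⟶ M) (hsr : s ≫ r = 𝟙 M) :
    ∃ (n : ℕ) (E : Fin n → C), (∀ k, P (E k)) ∧ Nonempty (M ≅ ⨁ fun k => Φ.obj (E k)) := by
  choose m Y hY e using fun k => hKS (E k)
  let e' := fun k => (e k).some
  let a : ∀ k l, E k ⟶ Y k l := fun k l => (e' k).hom ≫ biproduct.π _ l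
  let b : ∀ k l, Y k l ⟶ E k := fun k l => biproduct.ι _ l ≫ (e' k).inv
  have hab : ∀ k, ∑ l, a k l ≫ b k l = 𝟙 (E k) := fun k => by
    calc ∑ l, a k l ≫ b k l =
        (e' k).hom ≫ (∑ l, biproduct.π (Y k) l ≫ biproduct.ι (Y k) l) ≫ (e' k).inv := by
          simp only [a, b, Preadditive.sum_comp, Preadditive.comp_sum, Category.assoc]
      _ = 𝟙 (E k) := by rw [biproduct.total, Category.id_comp, Iso.hom_inv_id]
  have hba : ∀ k l, b k l ≫ a k l = 𝟙 _ := fun k l => by simp [a, b]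
  obtain ⟨N, σ, ⟨iso⟩⟩ := exists_iso_biproduct_of_sum_eq_id
    (ι := Σ k, Fin (m k)) (fun x => Φ.obj (Y x.1 x.2)) (fun x φ => by
      -- Fullness lets the alternative "`c` or `1 - c` is invertible" pass from the local ring `End
      -- (Y k l)` to the endomorphisms of its image, even if that image is zero.
      obtain ⟨c, rfl⟩ := Φ.map_surjective φ
      have := hY x.1 x.2
      obtain hc | hc := IsLocalRing.isUnit_or_isUnit_of_add_one (R := End (Y x.1 x.2))
        (a := c) (b := (𝟙 (Y x.1 x.2) - c : Y x.1 x.2 ⟶ Y x.1 x.2)) (add_sub_cancel c (𝟙 (Y x.1 x.2)))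
      · left
        have : IsIso c := (isUnit_iff_isIso _).1 hc
        infer_instance
      · right
        have h : IsIso (𝟙 (Y x.1 x.2) - c) := (isUnit_iff_isIso _).1 hc
        rw [← Φ.map_id, ← Φ.map_sub]
        infer_instance)
    (M := M) (fun x => s ≫ biproduct.π _ x.1 ≫ Φ.map (a x.1 x.2))
    (fun x => Φ.map (b x.1 x.2) ≫ biproduct.ι (fun k => Φ.obj (E k)) x.1 ≫ r) (by
      rw [Fintype.sum_sigma]
      have h1 : ∀ k, ∑ l, (s ≫ biproduct.π (fun k => Φ.obj (E k)) k ≫ Φ.map (a k l)) ≫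
          Φ.map (b k l) ≫ biproduct.ι (fun k => Φ.obj (E k)) k ≫ r =
          s ≫ (biproduct.π (fun k => Φ.obj (E k)) k ≫
            biproduct.ι (fun k => Φ.obj (E k)) k) ≫ r := fun k => by
        have h2 : ∑ l, Φ.map (a k l) ≫ Φ.map (b k l) = 𝟙 _ := by
          simp_rw [← Functor.map_comp]
          rw [← Functor.map_sum, hab, Φ.map_id]
        calc _ = s ≫ biproduct.π (fun k => Φ.obj (E k)) k ≫
              (∑ l, Φ.map (a k l) ≫ Φ.map (b k l)) ≫
              biproduct.ι (fun k => Φ.obj (E k)) k ≫ r := by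
                simp only [Preadditive.sum_comp, Preadditive.comp_sum, Category.assoc]
          _ = _ := by rw [h2, Category.assoc, Category.id_comp]
      refine (Finset.sum_congr rfl fun k _ => h1 k).trans ?_
      rw [← Preadditive.comp_sum, ← Preadditive.sum_comp, biproduct.total, Category.id_comp, hsr])
  exact ⟨N, fun k => Y (σ k).1 (σ k).2, fun k => P.prop_of_retract
    (⟨b (σ k).1 (σ k).2, a (σ k).1 (σ k).2, hba _ _⟩ : Retract _ (E (σ k).1)) (hE _), ⟨iso⟩⟩

/-- A retract of a finite sum of standard modules is a finite sum of standard modules. -/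
theorem exists_iso_biproduct_standard_of_retract (hKS : IsKrullSchmidt C)
    (hB : ∀ i, (B i).IsStableUnderRetracts) {i : ℕ} {n : ℕ} {E : Fin n → C}
    (hE : ∀ k, B (i + 1) (E k)) {M : LMod K Cᵒᵖ} (s : M ⟶ ⨁ fun k => standard K B i (E k))
    (r : (⨁ fun k => standard K B i (E k)) ⟶ M) (hsr : s ≫ r = 𝟙 M) :
    ∃ (n : ℕ) (E : Fin n → C), (∀ k, B (i + 1) (E k)) ∧
      Nonempty (M ≅ ⨁ fun k => standard K B i (E k)) := by
  have := hB (i + 1)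
  exact exists_iso_biproduct_map_of_retract hKS (factorIdeal K (B i)).rowQuotFunctor hE s r hsr

/-- The class of modules with a `Δ`-filtration is closed under kernels of epimorphisms. -/
theorem HasDeltaFiltration.of_shortExact (hKS : IsKrullSchmidt C)
    (hB : IsExhaustiveFiltration B) (S : ShortComplex (LMod K Cᵒᵖ)) (hS : S.ShortExact)
    (h₂ : HasDeltaFiltration B S.X₂) (h₃ : HasDeltaFiltration B S.X₃) :
    HasDeltaFiltration B S.X₁ := by
  obtain ⟨hf, hex, hg⟩ := (shortExact_iff S).1 hS
  have hsec : ∀ i, ∃ s, s ≫ traceFactorMap B i S.g = 𝟙 _ := fun i => by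
    obtain ⟨n, E, -, ⟨e⟩⟩ := h₃ i
    exact exists_section_of_iso_biproduct_standard (fun E hE => traceFactor_eq_zero i hE) _
      (traceFactorMap_surjective i hg) e
  choose s hs using hsec
  have key : ∀ i Y x, (S.f.hom.app Y).hom x ∈ (trace (B i) S.X₂).carrier Y →
      x ∈ (trace (B i) S.X₁).carrier Y := by
    intro i
    induction i with
    | zero =>
      intro Y x hx
      have h0 := trace_isZero_eq_zero (fun X => (hB.zero X).1) hx
      rw [hf Y (h0.trans (map_zero _).symm)]
      exact Submodule.zero_mem _
    | succ i ih => exact mem_trace_succ_of_map_mem hB.mono i S.zero hex hg (hs i) ih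
  intro i
  let T : ShortComplex (LMod K Cᵒᵖ) :=
    ShortComplex.mk (traceFactorMap B i S.f) (traceFactorMap B i S.g) (lmod_hom_ext fun Y z => by
      obtain ⟨x, hx, rfl⟩ := traceMk_surjective i z
      rw [comp_app_apply, traceFactorMap_traceMk, traceFactorMap_traceMk]
      refine (traceMk_eq_zero_iff i _).2 ?_
      rw [← comp_app_apply, S.zero]
      exact Submodule.zero_mem _)
  have hT : T.ShortExact := (shortExact_iff T).2 ⟨traceFactorMap_injective i (key i),
    traceFactorMap_exact i hex hg (hs i), traceFactorMap_surjective i hg⟩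
  -- The same section splits the sequence of factors, so the factor of `F'` is a retract of that of
  -- `F`.
  let sp := ShortComplex.Splitting.ofExactOfSection T hT.exact (s i) (hs i) hT.mono_f
  obtain ⟨n, E, hE, ⟨e⟩⟩ := h₂ i
  refine exists_iso_biproduct_standard_of_retract hKS hB.summands hE (T.f ≫ e.hom)
    (e.inv ≫ sp.r) ?_
  rw [Category.assoc, e.hom_inv_id_assoc, sp.f_r]

end KernelsOfEpimorphisms

/-! ### Objects without higher extensions by a fixed object. -/

section ExtAcyclic

open Abelian

universe w

variable {A : Type*} [Category* A] [Abelian A] [HasExt.{w} A]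

/-- The objects without higher extensions by `N`. -/
def IsExtAcyclic (N F : A) : Prop := ∀ t, 1 ≤ t → Subsingleton (Ext F N t)

variable {N : A}

theorem IsExtAcyclic.of_projective (P : A) [Projective P] : IsExtAcyclic N P := by
  rintro (_ | t) ht
  · omega
  · exact ⟨fun x y => (Ext.eq_zero_of_projective x).trans (Ext.eq_zero_of_projective y).symm⟩

theorem IsExtAcyclic.of_retract {X M : A} (h : IsExtAcyclic N X) (s : M ⟶ X) (r : X ⟶ M)
    (hsr : s ≫ r = 𝟙 M) : IsExtAcyclic N M := by
  intro t ht
  have := h t ht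
  refine subsingleton_of_forall_eq 0 fun x => ?_
  rw [← Ext.mk₀_id_comp x, ← hsr, ← Ext.mk₀_comp_mk₀_assoc,
    Subsingleton.elim ((Ext.mk₀ r).comp x (zero_add t)) 0, Ext.comp_zero]

theorem IsExtAcyclic.of_iso {X M : A} (h : IsExtAcyclic N X) (e : M ≅ X) : IsExtAcyclic N M :=
  h.of_retract e.hom e.inv e.hom_inv_id

theorem IsExtAcyclic.biproduct [HasFiniteBiproducts A] {n : ℕ} {X : Fin n → A} (h : ∀ k, IsExtAcyclic N (X k)) :
    IsExtAcyclic N (⨁ X) := by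
  intro t ht
  have := fun k => h k t ht
  exact (Ext.biproductAddEquiv (biproduct.isBilimit X) N t).injective.subsingleton

theorem IsExtAcyclic.middle {S : ShortComplex A} (hS : S.ShortExact) (h₁ : IsExtAcyclic N S.X₁)
    (h₃ : IsExtAcyclic N S.X₃) : IsExtAcyclic N S.X₂ := by
  intro t ht
  have := h₁ t ht
  have := h₃ t ht
  refine subsingleton_of_forall_eq 0 fun x => ?_
  obtain ⟨y, rfl⟩ := Ext.contravariant_sequence_exact₂ hS N x (Subsingleton.elim _ _)
  rw [Subsingleton.elim y 0, Ext.comp_zero]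

/-- In the long exact sequence every class on `S.X₃` comes from one on `S.X₁` in one degree less. In
positive degree that one is zero; in degree zero it is a morphism, which `h` extends to `S.X₂`, so
its connecting image vanishes. -/
theorem IsExtAcyclic.right {S : ShortComplex A} (hS : S.ShortExact) (h₁ : IsExtAcyclic N S.X₁)
    (h₂ : IsExtAcyclic N S.X₂) (h : ∀ φ : S.X₁ ⟶ N, ∃ ψ : S.X₂ ⟶ N, S.f ≫ ψ = φ) :
    IsExtAcyclic N S.X₃ := by
  rintro (_ | t) ht
  · omega
  have := h₂ (t + 1) ht
  refine subsingleton_of_forall_eq 0 fun x => ?_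
  obtain ⟨y, rfl⟩ := Ext.contravariant_sequence_exact₃ hS N x (Subsingleton.elim _ _)
    (add_comm 1 t)
  obtain _ | t := t
  · obtain ⟨φ, rfl⟩ := Ext.homEquiv₀.symm.surjective y
    obtain ⟨ψ, rfl⟩ := h φ
    change hS.extClass.comp (Ext.mk₀ (S.f ≫ ψ)) _ = 0
    rw [← Ext.mk₀_comp_mk₀, ← Ext.comp_assoc (h₁₂ := add_zero 1) (h := by lia),
      hS.extClass_comp, Ext.zero_comp]
  · have := h₁ (t + 1) (by omega)
    rw [Subsingleton.elim y 0, Ext.comp_zero]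

end ExtAcyclic

/-! ### Linear forms on tensor products, and the passage from Ext to Tor. -/

section TensorDual

variable {K : Type v} [Field K] {D : Type u} [Category.{v} D] [Preadditive D] [Linear K D]

open Classical in
/-- The class of `x ⊗ m` in the tensor product of two modules. -/
def tensorMk (F : LMod K Dᵒᵖ) (M : LMod K D) (X : D) :
    F.obj.obj (op X) ⊗[K] M.obj.obj X →ₗ[K] (tensor M).obj F :=
  (tensorRel F M).mkQ ∘ₗ DirectSum.lof K D (fun X => F.obj.obj (op X) ⊗[K] M.obj.obj X) X

theorem tensorMk_map_tmul (F : LMod K Dᵒᵖ) (M : LMod K D) {X Y : D} (f : X ⟶ Y)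
    (x : F.obj.obj (op Y)) (m : M.obj.obj X) :
    tensorMk F M X ((F.obj.map f.op).hom x ⊗ₜ m) = tensorMk F M Y (x ⊗ₜ (M.obj.map f).hom m) :=
  (Submodule.Quotient.eq _).2 (Submodule.subset_span ⟨X, Y, f, x, m, rfl⟩)

theorem tensor_map_tensorMk {F F' : LMod K Dᵒᵖ} (φ : F ⟶ F') (M : LMod K D) (X : D)
    (x : F.obj.obj (op X)) (m : M.obj.obj X) :
    ((tensor M).map φ).hom (tensorMk F M X (x ⊗ₜ m)) =
      tensorMk F' M X ((φ.hom.app (op X)).hom x ⊗ₜ m) := by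
  classical
  change (tensorRel F' M).mkQ (tensorPre φ M (DirectSum.lof K D
    (fun X => F.obj.obj (op X) ⊗[K] M.obj.obj X) X (x ⊗ₜ m))) = _
  rw [tensorPre, DirectSum.lmap_lof]
  rfl

theorem tensor_linearMap_ext {F : LMod K Dᵒᵖ} {M : LMod K D} {V : Type*} [AddCommGroup V]
    [Module K V] {f g : (tensor M).obj F →ₗ[K] V}
    (h : ∀ X x m, f (tensorMk F M X (x ⊗ₜ m)) = g (tensorMk F M X (x ⊗ₜ m))) : f = g := by
  classical
  refine Submodule.linearMap_qext _ (DirectSum.linearMap_ext _ fun X => ?_)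
  exact TensorProduct.ext' fun x m => h X x m

/-- A linear form on `F ⊗ M` defines a morphism from `F` to the dual of `M`. -/
def homDualOfForm {F : LMod K Dᵒᵖ} {M : LMod K D} (l : (tensor M).obj F →ₗ[K] K) : F ⟶ dual M :=
  ObjectProperty.homMk
    { app := fun X => ModuleCat.ofHom
        (TensorProduct.curry (l ∘ₗ tensorMk F M (unop X)))
      naturality := fun X Y a => by
        ext x
        refine LinearMap.ext fun m => ?_
        exact congrArg l (tensorMk_map_tmul F M a.unop x m) }

theorem homDualOfForm_apply {F : LMod K Dᵒᵖ} {M : LMod K D} (l : (tensor M).obj F →ₗ[K] K) (X : D)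
    (x : F.obj.obj (op X)) (m : M.obj.obj X) :
    (show Module.Dual K (M.obj.obj X) from ((homDualOfForm l).hom.app (op X)).hom x) m =
      l (tensorMk F M X (x ⊗ₜ m)) := rfl

/-- The bilinear map given by the value at `X` of a morphism from `F` to the dual of `M`. -/
def pairingOfHomDual {F : LMod K Dᵒᵖ} {M : LMod K D} (φ : F ⟶ dual M) (X : D) :
    F.obj.obj (op X) ⊗[K] M.obj.obj X →ₗ[K] K :=
  TensorProduct.lift (show F.obj.obj (op X) →ₗ[K] M.obj.obj X →ₗ[K] K from
    (φ.hom.app (op X)).hom)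

theorem pairingOfHomDual_tmul {F : LMod K Dᵒᵖ} {M : LMod K D} (φ : F ⟶ dual M) (X : D)
    (x : F.obj.obj (op X)) (m : M.obj.obj X) : pairingOfHomDual φ X (x ⊗ₜ m) =
      (show Module.Dual K (M.obj.obj X) from (φ.hom.app (op X)).hom x) m :=
  TensorProduct.lift.tmul _ _

open Classical in
/-- A morphism from `F` to the dual of `M` defines a linear form on `F ⊗ M`. -/
def formOfHomDual {F : LMod K Dᵒᵖ} {M : LMod K D} (φ : F ⟶ dual M) : (tensor M).obj F →ₗ[K] K :=
  (tensorRel F M).liftQ (DirectSum.toModule K D K (pairingOfHomDual φ)) <| by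
    refine Submodule.span_le.2 ?_
    rintro _ ⟨X, Y, f, x, m, rfl⟩
    rw [SetLike.mem_coe, LinearMap.mem_ker, map_sub, DirectSum.toModule_lof,
      DirectSum.toModule_lof, pairingOfHomDual_tmul, pairingOfHomDual_tmul, sub_eq_zero]
    exact LinearMap.congr_fun
      (show (show Module.Dual K (M.obj.obj X) from _) = _ from naturality_apply φ f.op x) m

theorem formOfHomDual_tensorMk {F : LMod K Dᵒᵖ} {M : LMod K D} (φ : F ⟶ dual M) (X : D)
    (x : F.obj.obj (op X)) (m : M.obj.obj X) :
    formOfHomDual φ (tensorMk F M X (x ⊗ₜ m)) =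
      (show Module.Dual K (M.obj.obj X) from (φ.hom.app (op X)).hom x) m := by
  classical
  refine Eq.trans ?_ (pairingOfHomDual_tmul φ X x m)
  exact DirectSum.toModule_lof K (M := fun X => F.obj.obj (op X) ⊗[K] M.obj.obj X)
    (φ := pairingOfHomDual φ) X (x ⊗ₜ m)

/-- `Tor` vanishes where `Ext` with values in the dual module vanishes. -/
theorem isZero_tor_of_subsingleton_ext [EssentiallySmall.{v} D] (F : LMod K Dᵒᵖ) (M : LMod K D)
    (t : ℕ) (ht : 1 ≤ t) (h : Subsingleton (Abelian.Ext F (dual M) t)) : IsZero (Tor t F M) := by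
  obtain ⟨s, rfl⟩ : ∃ s, t = s + 1 := ⟨t - 1, by omega⟩
  let R := projectiveResolution F
  refine IsZero.of_iso ?_ (R.isoLeftDerivedObj (tensor M) (s + 1))
  change IsZero ((((tensor M).mapHomologicalComplex _).obj R.complex).homology (s + 1))
  rw [← HomologicalComplex.exactAt_iff_isZero_homology,
    HomologicalComplex.exactAt_iff' _ (s + 2) (s + 1) s (by simp) (by simp),
    ShortComplex.moduleCat_exact_iff]
  intro x hx
  change ((tensor M).map (R.complex.d (s + 1) s)).hom x = 0 at hx
  change ∃ y, ((tensor M).map (R.complex.d (s + 2) (s + 1))).hom y = x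
  by_contra hne
  -- A cycle that is not a boundary is separated from the boundaries by a linear form `l`. Killing
  -- boundaries means that `l`, read as a morphism to `dual M`, is a cocycle.
  obtain ⟨l, hlx, hl⟩ := Submodule.exists_le_ker_of_notMem
    (p := LinearMap.range ((tensor M).map (R.complex.d (s + 2) (s + 1))).hom) (v := x) hne
  have hcocycle : R.complex.d (s + 2) (s + 1) ≫ homDualOfForm l = 0 :=
    lmod_hom_ext fun X y => LinearMap.ext fun m => by
      refine (homDualOfForm_apply l (unop X) _ m).trans ?_
      have := tensor_map_tensorMk (R.complex.d (s + 2) (s + 1)) M (unop X) y m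
      exact (congrArg l this).symm.trans (hl ⟨_, rfl⟩)
  obtain ⟨ψ, hψ⟩ := (R.extMk_eq_zero_iff (homDualOfForm l) (s + 2) rfl hcocycle s rfl).1
    (Subsingleton.elim _ _)
  -- The cocycle is a coboundary, so `l` factors through the differential and vanishes on the cycle
  -- `x`: a contradiction.
  have : l = formOfHomDual ψ ∘ₗ ((tensor M).map (R.complex.d (s + 1) s)).hom :=
    tensor_linearMap_ext fun X x m => by
      rw [LinearMap.comp_apply, tensor_map_tensorMk, formOfHomDual_tensorMk,
        ← homDualOfForm_apply, ← comp_app_apply, hψ]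
  exact hlx ((LinearMap.congr_fun this x).trans
    ((congrArg (formOfHomDual ψ) hx).trans (map_zero _)))

end TensorDual

/-! ### Modules over `D / I` as modules over `D`. -/

section Restriction

variable {K : Type v} [Field K] {D : Type u} [Category.{v} D] [Preadditive D] [Linear K D]

namespace CatIdeal

variable (I : CatIdeal K D)

/-- Restriction of modules along the quotient functor `D ⥤ D / I`. -/
def restriction : LMod K I.Quotᵒᵖ ⥤ LMod K Dᵒᵖ where
  obj M := ⟨(Quotient.functor I.rel).op ⋙ M.obj,
    ⟨fun {X Y f g} => (congrArg M.obj.map (show (Quotient.functor I.rel).op.map (f + g) =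
      (Quotient.functor I.rel).op.map f + (Quotient.functor I.rel).op.map g from rfl)).trans
        M.obj.map_add⟩,
    ⟨fun {X Y} f r => (congrArg M.obj.map (show (Quotient.functor I.rel).op.map (r • f) =
      r • (Quotient.functor I.rel).op.map f from rfl)).trans (M.obj.map_smul r _)⟩⟩
  map φ := ObjectProperty.homMk (Functor.whiskerLeft _ φ.hom)

instance : I.restriction.Additive where

theorem functor_map_eq_zero_iff {X Y : D} (a : X ⟶ Y) :
    (Quotient.functor I.rel).map a = 0 ↔ a ∈ I.carrier X Y := by
  rw [← Functor.map_zero, Quotient.functor_map_eq_iff, rel_iff, sub_zero]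

/-- The module `D(-, X) / I(-, X)` is the restriction of the module represented by `X` over
`D / I`. -/
def rowQuotToRestriction (X : D) :
    (I.row X).quot ⟶ I.restriction.obj (rep K ((Quotient.functor I.rel).obj X)) :=
  I.rowQuotLift (M := I.restriction.obj (rep K ((Quotient.functor I.rel).obj X)))
    (𝟙 ((Quotient.functor I.rel).obj X)) fun Y a ha => by
      refine Eq.trans (Category.comp_id ((Quotient.functor I.rel).map a)) ?_
      exact (I.functor_map_eq_zero_iff a).2 ha

theorem rowQuotToRestriction_proj {X Y : D} (a : Y ⟶ X) :
    ((I.rowQuotToRestriction X).hom.app (op Y)).hom (((I.row X).proj.hom.app (op Y)).hom a) =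
      (Quotient.functor I.rel).map a :=
  Category.comp_id ((Quotient.functor I.rel).map a)

instance (X : D) : IsIso (I.rowQuotToRestriction X) := by
  refine isIso_of_bijective _ fun Y => ⟨(injective_iff_map_eq_zero _).2 fun z hz => ?_, fun z => ?_⟩
  · obtain ⟨a, rfl⟩ := (I.row X).proj_surjective Y z
    refine ((I.row X).proj_eq_zero_iff a).2 ((I.functor_map_eq_zero_iff (X := unop Y) a).1 ?_)
    exact (I.rowQuotToRestriction_proj (Y := unop Y) a).symm.trans hz
  · obtain ⟨a, rfl⟩ := (Quotient.functor I.rel).map_surjective (X := unop Y) (Y := X) z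
    exact ⟨((I.row X).proj.hom.app Y).hom a, I.rowQuotToRestriction_proj (Y := unop Y) a⟩

end CatIdeal

end Restriction

/-! ### The layers `J(-, X) / I(-, X)`. -/

section Layers

variable {K : Type v} [Field K] {D : Type u} [Category.{v} D] [Preadditive D] [Linear K D]

namespace CatIdeal

variable (J I : CatIdeal K D)

/-- The module `J(-, X) / I(-, X)`, for ideals `I ⊆ J`. -/
abbrev layer (X : D) : LMod K Dᵒᵖ :=
  I.restriction.obj ((J.image I).row ((Quotient.functor I.rel).obj X)).toLMod

/-- The inclusion of `J(-, X) / I(-, X)` in `D(-, X) / I(-, X)`. -/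
def layerIncl (X : D) : layer J I X ⟶ (I.row X).quot :=
  I.restriction.map (Sub.incl _) ≫ inv (I.rowQuotToRestriction X)

theorem layerIncl_comp (X : D) : layerIncl J I X ≫ I.rowQuotToRestriction X =
    I.restriction.map ((J.image I).row ((Quotient.functor I.rel).obj X)).incl := by
  rw [layerIncl, Category.assoc, IsIso.inv_hom_id, Category.comp_id]

theorem rowQuotToRestriction_injective (X : D) (Y : Dᵒᵖ) :
    Function.Injective ((I.rowQuotToRestriction X).hom.app Y).hom :=
  (mono_iff_injective _).1 inferInstance Y

theorem layerIncl_apply (X : D) (Y : Dᵒᵖ) (r : (layer J I X).obj.obj Y) :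
    ((I.rowQuotToRestriction X).hom.app Y).hom (((layerIncl J I X).hom.app Y).hom r) =
      ((I.restriction.map ((J.image I).row ((Quotient.functor I.rel).obj X)).incl).hom.app Y).hom
        r := by
  rw [← layerIncl_comp, comp_app_apply]

theorem layerIncl_injective (X : D) (Y : Dᵒᵖ) :
    Function.Injective ((layerIncl J I X).hom.app Y).hom := by
  intro a b hab
  have h := congrArg ((I.rowQuotToRestriction X).hom.app Y).hom hab
  rw [layerIncl_apply, layerIncl_apply] at h
  exact Sub.incl_injective ((J.image I).row ((Quotient.functor I.rel).obj X)) _ h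

theorem exists_layerIncl_eq {X Y : D} {a : Y ⟶ X} (ha : a ∈ J.carrier Y X) :
    ∃ r, ((layerIncl J I X).hom.app (op Y)).hom r = ((I.row X).proj.hom.app (op Y)).hom a :=
  ⟨⟨(Quotient.functor I.rel).map a, a, ha, rfl⟩, I.rowQuotToRestriction_injective X _
    ((layerIncl_apply J I X (op Y) _).trans (I.rowQuotToRestriction_proj a).symm)⟩

theorem exists_proj_eq_layerIncl {X Y : D} (r : (layer J I X).obj.obj (op Y)) :
    ∃ a ∈ J.carrier Y X,
      ((layerIncl J I X).hom.app (op Y)).hom r = ((I.row X).proj.hom.app (op Y)).hom a := by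
  obtain ⟨b, a, ha, rfl⟩ := r
  exact ⟨a, ha, I.rowQuotToRestriction_injective X _
    ((layerIncl_apply J I X (op Y) _).trans (I.rowQuotToRestriction_proj (Y := Y) a).symm)⟩

variable {I J}

/-- The projection `D(-, X) / I(-, X) ⟶ D(-, X) / J(-, X)`, for ideals `I ⊆ J`. -/
def rowQuotProj (hIJ : ∀ X Y, I.carrier X Y ≤ J.carrier X Y) (X : D) :
    (I.row X).quot ⟶ (J.row X).quot :=
  (I.row X).desc (J.row X).proj fun Y _ hx => ((J.row X).proj_eq_zero_iff _).2 (hIJ (unop Y) X hx)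

/-- The sequence `0 ⟶ J(-, X) / I(-, X) ⟶ D(-, X) / I(-, X) ⟶ D(-, X) / J(-, X) ⟶ 0`. -/
def layerSequence (hIJ : ∀ X Y, I.carrier X Y ≤ J.carrier X Y) (X : D) :
    ShortComplex (LMod K Dᵒᵖ) :=
  ShortComplex.mk (layerIncl J I X) (rowQuotProj hIJ X) (lmod_hom_ext fun Y r => by
    obtain ⟨a, ha, h⟩ := exists_proj_eq_layerIncl J I (Y := unop Y) r
    rw [comp_app_apply]
    erw [h]
    exact ((J.row X).proj_eq_zero_iff _).2 ha)

theorem layerSequence_shortExact (hIJ : ∀ X Y, I.carrier X Y ≤ J.carrier X Y) (X : D) :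
    (layerSequence hIJ X).ShortExact := by
  refine (shortExact_iff _).2 ⟨layerIncl_injective J I X, fun Y y hy => ?_, fun Y z => ?_⟩
  · obtain ⟨a, rfl⟩ := (I.row X).proj_surjective Y y
    exact exists_layerIncl_eq J I (Y := unop Y) (((J.row X).proj_eq_zero_iff a).1 hy)
  · obtain ⟨a, rfl⟩ := (J.row X).proj_surjective Y z
    exact ⟨((I.row X).proj.hom.app Y).hom a, rfl⟩

/-- Over `D / I` the layer is finitely generated projective, hence a summand of a finite sum of
representables; restriction to `D` is additive and turns these into modules `D(-, E) / I(-, E)`. -/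
theorem exists_layer_retract (h : IsHeredity (J.image I)) (X : D) :
    ∃ (n : ℕ) (E : Fin n → D) (s : layer J I X ⟶ ⨁ fun k => (I.row (E k)).quot)
      (r : (⨁ fun k => (I.row (E k)).quot) ⟶ layer J I X), s ≫ r = 𝟙 _ := by
  obtain ⟨⟨n, E, p, hp⟩, hproj⟩ := h.projective ((Quotient.functor I.rel).obj X)
  let e : I.restriction.obj (⨁ fun k => rep K (E k)) ≅ ⨁ fun k => (I.row (E k).as).quot :=
    I.restriction.mapBiproduct _ ≪≫ biproduct.mapIso fun k =>
      (asIso (I.rowQuotToRestriction (E k).as)).symm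
  refine ⟨n, fun k => (E k).as, I.restriction.map (Projective.factorThru (𝟙 _) p) ≫ e.hom,
    e.inv ≫ I.restriction.map p, ?_⟩
  rw [Category.assoc, e.hom_inv_id_assoc, ← Functor.map_comp, Projective.factorThru_comp]
  exact I.restriction.map_id _

/-- The layer is generated by its values on `P`: the class of `g ≫ h` through `E` is the restriction
along `g` of the class of `h`, an element at `E`, where `N` vanishes. -/
theorem hom_layer_factorIdeal_eq_zero {P : ObjectProperty D} {I : CatIdeal K D} {X : D}
    {N : LMod K Dᵒᵖ} (hN : ∀ E, P E → ∀ x : N.obj.obj (op E), x = 0)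
    (φ : layer (factorIdeal K P) I X ⟶ N) : φ = 0 := by
  let L := layerIncl (factorIdeal K P) I X
  have hL := layerIncl_injective (factorIdeal K P) I X
  refine lmod_hom_ext fun Y r => ?_
  obtain ⟨a, ha, h⟩ := exists_proj_eq_layerIncl (factorIdeal K P) I (Y := unop Y) r
  change (φ.hom.app Y).hom r = 0
  -- The span induction runs over the representative `a`; `r` is quantified inside, and injectivity
  -- of `L` recovers it from `a`.
  have key : ∀ a ∈ (factorIdeal K P).carrier (unop Y) X, ∀ r,
      (L.hom.app Y).hom r = ((I.row X).proj.hom.app Y).hom a → (φ.hom.app Y).hom r = 0 := by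
    intro a ha
    refine Submodule.span_induction (p := fun a _ => ∀ r,
      (L.hom.app Y).hom r = ((I.row X).proj.hom.app Y).hom a → (φ.hom.app Y).hom r = 0)
      ?_ ?_ ?_ ?_ ha
    · rintro _ ⟨E, g, h, hE, rfl⟩ r hr
      obtain ⟨t, ht⟩ := exists_layerIncl_eq (factorIdeal K P) I (X := X) (Y := E) (a := h)
        (Submodule.subset_span ⟨E, 𝟙 E, h, hE, (Category.id_comp h).symm⟩)
      have hrt : r = ((layer (factorIdeal K P) I X).obj.map g.op).hom t := by
        apply hL
        rw [naturality_apply, ht]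
        refine hr.trans ?_
        exact naturality_apply (I.row X).proj g.op h
      rw [hrt, naturality_apply]
      exact (congrArg _ (hN E hE _)).trans (map_zero _)
    · intro r hr
      have : r = 0 := hL Y (hr.trans ((map_zero ((I.row X).proj.hom.app Y).hom).trans
        (map_zero _).symm))
      rw [this, map_zero]
    · intro a b ha hb iha ihb r hr
      obtain ⟨s, hs⟩ := exists_layerIncl_eq (factorIdeal K P) I ha
      obtain ⟨t, ht⟩ := exists_layerIncl_eq (factorIdeal K P) I hb
      have : r = s + t := hL Y <| by
        rw [map_add]
        refine hr.trans ((map_add ((I.row X).proj.hom.app Y).hom a b).trans ?_)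
        exact congrArg₂ (· + ·) hs.symm ht.symm
      rw [this, map_add, iha s hs, ihb t ht, add_zero]
    · intro c a ha iha r hr
      obtain ⟨s, hs⟩ := exists_layerIncl_eq (factorIdeal K P) I ha
      have : r = c • s := hL Y <| by
        rw [map_smul]
        refine hr.trans ((map_smul ((I.row X).proj.hom.app Y).hom c a).trans ?_)
        exact congrArg (c • ·) hs.symm
      rw [this, map_smul, iha s hs, smul_zero]
  exact key a ha r h

end CatIdeal

theorem factorIdeal_mono {P Q : ObjectProperty D} (h : P ≤ Q) (X Y : D) :
    (factorIdeal K P).carrier X Y ≤ (factorIdeal K Q).carrier X Y := by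
  refine Submodule.span_mono ?_
  rintro _ ⟨E, a, b, hE, rfl⟩
  exact ⟨E, a, b, h E hE, rfl⟩

end Layers

/-! ### Relative injectivity of the costandard modules. -/

section Costandard

variable {K : Type v} [Field K] {C : Type u} [Category.{v} C] [Preadditive C] [Linear K C]
  {B : ℕ → ObjectProperty C}

theorem costandard_eq_zero {j : ℕ} {E' E : C} (hE : B j E)
    (x : (costandard K B j E').obj.obj (op E)) : x = 0 := by
  refine LinearMap.ext fun m => ?_
  obtain ⟨a, rfl⟩ := ((factorIdeal K (B j)).col E').proj_surjective E m
  have : (((factorIdeal K (B j)).col E').proj.hom.app E).hom a = 0 := by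
    refine (((factorIdeal K (B j)).col E').proj_eq_zero_iff a).2
      (show (show E' ⟶ E from a) ∈ (factorIdeal K (B j)).carrier E' E from ?_)
    exact Submodule.subset_span ⟨E, _, 𝟙 E, hE, (Category.comp_id (show E' ⟶ E from a)).symm⟩
  exact (congrArg (show Module.Dual K ((standardOp K B j E').obj.obj E) from x) this).trans
    (map_zero _)

/-- The value at the class of the identity, of the forms in the costandard module at `E'`. -/
def costandardEval (B : ℕ → ObjectProperty C) (j : ℕ) (E' : C) :
    (costandard K B j E').obj.obj (op E') →ₗ[K] K :=
  Module.Dual.eval K ((standardOp K B j E').obj.obj E')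
    ((((factorIdeal K (B j)).col E').proj.hom.app E').hom (𝟙 E'))

theorem costandard_apply {j : ℕ} {E' Y : C} (x : (costandard K B j E').obj.obj (op Y))
    (a : E' ⟶ Y) :
    (show Module.Dual K ((standardOp K B j E').obj.obj Y) from x)
      ((((factorIdeal K (B j)).col E').proj.hom.app Y).hom a) =
      costandardEval B j E' (((costandard K B j E').obj.map a.op).hom x) := by
  refine congrArg (show Module.Dual K ((standardOp K B j E').obj.obj Y) from x) ?_
  refine Eq.trans ?_ (naturality_apply ((factorIdeal K (B j)).col E').proj a (𝟙 E'))
  exact congrArg (((factorIdeal K (B j)).col E').proj.hom.app Y).hom (Category.id_comp a).symm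

/-- The value of a form at `a : E' ⟶ Y` is the evaluation at the identity of its restriction along
`a`. With `exists_hom_costandard` this identifies `Hom(F, ∇)` with the dual of `F E'` when `F`
vanishes on `B j`. -/
theorem hom_costandard_ext {j : ℕ} {E' : C} {F : LMod K Cᵒᵖ} {φ ψ : F ⟶ costandard K B j E'}
    (h : ∀ x, costandardEval B j E' ((φ.hom.app (op E')).hom x) =
      costandardEval B j E' ((ψ.hom.app (op E')).hom x)) : φ = ψ := by
  refine lmod_hom_ext fun Y y => LinearMap.ext fun m => ?_
  obtain ⟨a, rfl⟩ := ((factorIdeal K (B j)).col E').proj_surjective (unop Y) m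
  refine (costandard_apply (Y := unop Y) _ a).trans
    (Eq.trans ?_ (costandard_apply (Y := unop Y) _ a).symm)
  rw [← naturality_apply, ← naturality_apply]
  exact h _

/-- Linear forms on `F E'` extend to morphisms to the costandard module at `E'`, when `F` vanishes
on `B j`. -/
theorem exists_hom_costandard {j : ℕ} {E' : C} {F : LMod K Cᵒᵖ}
    (hF : ∀ E, B j E → ∀ x : F.obj.obj (op E), x = 0) (l : F.obj.obj (op E') →ₗ[K] K) :
    ∃ φ : F ⟶ costandard K B j E',
      ∀ x, costandardEval B j E' ((φ.hom.app (op E')).hom x) = l x := by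
  let b : ∀ Y : C, F.obj.obj (op Y) →ₗ[K] (E' ⟶ Y) →ₗ[K] K := fun Y =>
    LinearMap.mk₂ K (fun y a => l ((F.obj.map a.op).hom y))
      (fun y y' a => by rw [map_add, map_add])
      (fun c y a => by rw [map_smul, map_smul])
      (fun y a a' => by rw [op_add, Functor.map_add, ModuleCat.hom_add, LinearMap.add_apply, map_add])
      (fun c y a => by
        have : (c • a).op = c • a.op := rfl
        rw [this, Functor.map_smul, ModuleCat.hom_smul, LinearMap.smul_apply, map_smul])
  have hb : ∀ Y y, ∀ a ∈ (factorIdeal K (B j)).carrier E' Y, b Y y a = 0 := fun Y y a ha =>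
    (congrArg l (map_eq_zero_of_mem_factorIdeal hF ha y)).trans (map_zero l)
  let c : ∀ Y : C, F.obj.obj (op Y) →ₗ[K]
      Module.Dual K ((E' ⟶ Y) ⧸ (factorIdeal K (B j)).carrier E' Y) := fun Y =>
    { toFun := fun y => Submodule.liftQ _ (b Y y) (hb Y y)
      map_add' := fun y y' => Submodule.linearMap_qext _ (map_add (b Y) y y')
      map_smul' := fun r y => Submodule.linearMap_qext _ (map_smul (b Y) r y) }
  refine ⟨ObjectProperty.homMk
    { app := fun Y => ModuleCat.ofHom (c (unop Y))
      naturality := fun Y Z f => by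
        ext y
        refine Submodule.linearMap_qext _ (LinearMap.ext fun a => ?_)
        exact congrArg l (map_comp_apply F f (show E' ⟶ unop Z from a).op y).symm }, fun x => ?_⟩
  exact congrArg l (map_id_apply F (op E') x)

/-- Morphisms to costandard modules extend along injections of modules that vanish on `B j`. -/
theorem exists_extension_costandard {j : ℕ} {E' : C} {F F' : LMod K Cᵒᵖ}
    (hF : ∀ E, B j E → ∀ x : F.obj.obj (op E), x = 0) (f : F' ⟶ F)
    (hf : ∀ X, Function.Injective (f.hom.app X).hom) (φ : F' ⟶ costandard K B j E') :
    ∃ ψ : F ⟶ costandard K B j E', f ≫ ψ = φ := by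
  -- The problem reduces to extending a linear form along an injection of vector spaces.
  obtain ⟨l, hl⟩ := LinearMap.dualMap_surjective_of_injective (hf (op E'))
    (costandardEval B j E' ∘ₗ (φ.hom.app (op E')).hom)
  obtain ⟨ψ, hψ⟩ := exists_hom_costandard hF l
  refine ⟨ψ, hom_costandard_ext fun x => ?_⟩
  rw [comp_app_apply, hψ]
  exact LinearMap.congr_fun hl x

end Costandard

/-! ### Vanishing of Ext on standard modules and on `F(Δ)`. -/

section Vanishing

variable {K : Type v} [Field K] {C : Type u} [Category.{v} C] [Preadditive C] [Linear K C]
  {B : ℕ → ObjectProperty C}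

theorem isExtAcyclic_layer {J I : CatIdeal K C} (h : IsHeredity (J.image I)) {N : LMod K Cᵒᵖ}
    (hN : ∀ X, IsExtAcyclic N (I.row X).quot) (X : C) :
    IsExtAcyclic N (CatIdeal.layer J I X) := by
  obtain ⟨n, E, s, r, hsr⟩ := CatIdeal.exists_layer_retract h X
  exact (IsExtAcyclic.biproduct fun k => hN (E k)).of_retract s r hsr

/-- The modules `C(-, X) / I_{B i}(-, X)` have no higher extensions by modules that vanish on
`B i`. -/
theorem isExtAcyclic_standard_of_vanishing (hB : IsExhaustiveFiltration B)
    (hqh : IsQuasiHereditary K B) (i : ℕ) :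
    ∀ (N : LMod K Cᵒᵖ), (∀ E, B i E → ∀ x : N.obj.obj (op E), x = 0) →
      ∀ X, IsExtAcyclic N (standard K B i X) := by
  induction i with
  | zero =>
    intro N _ X
    -- Every module vanishes on the zero objects, so relative projectivity is projectivity here.
    have : Projective (standard K B 0 X) :=
      ⟨fun {M P} f e _ => exists_rowQuot_lift (fun E hE => isZero_eval ((hB.zero E).1 hE) M) e
        ((epi_iff_surjective K e).1 inferInstance) f⟩
    exact IsExtAcyclic.of_projective _
  | succ i ih =>
    intro N hN X
    have hN' := ih N fun E hE => hN E (hB.mono (Nat.le_succ i) E hE)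
    refine IsExtAcyclic.right (CatIdeal.layerSequence_shortExact
      (factorIdeal_mono (hB.mono (Nat.le_succ i))) X) (isExtAcyclic_layer (hqh i) hN' X) (hN' X) ?_
    intro φ
    refine ⟨0, ?_⟩
    rw [comp_zero]
    exact (CatIdeal.hom_layer_factorIdeal_eq_zero hN φ).symm

/-- Induction upwards from `i = j`, where the costandard module vanishes on `B j`. Beyond that,
morphisms from a layer need not be zero, but they extend, because `C(-, X) / I_{B (j+d)}(-, X)`
vanishes on `B j`. -/
theorem isExtAcyclic_standard_of_le (hB : IsExhaustiveFiltration B)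
    (hqh : IsQuasiHereditary K B) (j d : ℕ) (E' : C) :
    ∀ X, IsExtAcyclic (costandard K B j E') (standard K B (j + d) X) := by
  induction d with
  | zero => exact isExtAcyclic_standard_of_vanishing hB hqh j _ fun E hE => costandard_eq_zero hE
  | succ d ih =>
    intro X
    refine IsExtAcyclic.right (CatIdeal.layerSequence_shortExact
      (factorIdeal_mono (hB.mono (Nat.le_succ (j + d)))) X) (isExtAcyclic_layer (hqh _) ih X)
      (ih X) ?_
    refine exists_extension_costandard (fun E hE x => ?_) _ (CatIdeal.layerIncl_injective _ _ X)
    exact rowQuot_eq_zero X (hB.mono (Nat.le_add_right j d) E hE) x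

theorem isExtAcyclic_standard (hB : IsExhaustiveFiltration B)
    (hqh : IsQuasiHereditary K B) (i j : ℕ) (E' X : C) :
    IsExtAcyclic (costandard K B j E') (standard K B i X) := by
  obtain h | h := le_total j i
  · obtain ⟨d, rfl⟩ := Nat.exists_eq_add_of_le h
    exact isExtAcyclic_standard_of_le hB hqh j d E' X
  · exact isExtAcyclic_standard_of_vanishing hB hqh i _
      (fun E hE => costandard_eq_zero (hB.mono h E hE)) X

/-- The inclusion of consecutive terms of the trace filtration. -/
def traceIncl (hB : Monotone B) (i : ℕ) (F : LMod K Cᵒᵖ) :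
    (trace (B i) F).toLMod ⟶ (trace (B (i + 1)) F).toLMod :=
  Sub.lift _ (Sub.incl _) fun Y x => trace_mono (hB (Nat.le_succ i)) F Y x.2

theorem traceIncl_comp_traceProj (hB : Monotone B) (i : ℕ) (F : LMod K Cᵒᵖ) :
    traceIncl hB i F ≫ traceProj B i F = 0 := by
  refine lmod_hom_ext fun Y x => ?_
  exact (traceMk_eq_zero_iff (B := B) i (F := F) (Y := Y)
    (x := ((trace (B i) F).incl.hom.app Y).hom x)
    (trace_mono (hB (Nat.le_succ i)) F Y (Sub.incl_mem _ Y x))).2 (Sub.incl_mem _ Y x)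

/-- The sequence `0 ⟶ F^{(i)} ⟶ F^{(i + 1)} ⟶ F^{(i + 1)} / F^{(i)} ⟶ 0`. -/
def traceSequence (hB : Monotone B) (i : ℕ) (F : LMod K Cᵒᵖ) : ShortComplex (LMod K Cᵒᵖ) :=
  ShortComplex.mk (traceIncl hB i F) (traceProj B i F) (traceIncl_comp_traceProj hB i F)

theorem traceIncl_apply (hB : Monotone B) (i : ℕ) (F : LMod K Cᵒᵖ) (Y : Cᵒᵖ)
    (x : (trace (B i) F).toLMod.obj.obj Y) :
    ((trace (B (i + 1)) F).incl.hom.app Y).hom (((traceIncl hB i F).hom.app Y).hom x) =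
      ((trace (B i) F).incl.hom.app Y).hom x := by
  rw [← comp_app_apply, traceIncl, Sub.lift_incl]

theorem traceIncl_injective (hB : Monotone B) (i : ℕ) (F : LMod K Cᵒᵖ) (Y : Cᵒᵖ) :
    Function.Injective ((traceIncl hB i F).hom.app Y).hom := by
  intro x y h
  apply Sub.incl_injective (trace (B i) F) Y
  rw [← traceIncl_apply hB, h, traceIncl_apply]

theorem exists_traceIncl_eq (hB : Monotone B) (i : ℕ) (F : LMod K Cᵒᵖ) (Y : Cᵒᵖ)
    (x : (trace (B (i + 1)) F).toLMod.obj.obj Y)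
    (hx : ((traceProj B i F).hom.app Y).hom x = 0) :
    ∃ y, ((traceIncl hB i F).hom.app Y).hom y = x := by
  have h : ((trace (B (i + 1)) F).incl.hom.app Y).hom x ∈ (trace (B i) F).carrier Y :=
    (Sub.proj_eq_zero_iff ((trace (B i) F).restrict (trace (B (i + 1)) F)) x).1 hx
  obtain ⟨y, hy⟩ := Sub.exists_incl_eq _ h
  refine ⟨y, Sub.incl_injective (trace (B (i + 1)) F) Y ?_⟩
  rw [traceIncl_apply, hy]

theorem traceProj_surjective (i : ℕ) (F : LMod K Cᵒᵖ) (Y : Cᵒᵖ) :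
    Function.Surjective ((traceProj B i F).hom.app Y).hom :=
  Sub.proj_surjective _ Y

theorem traceSequence_shortExact (hB : Monotone B) (i : ℕ) (F : LMod K Cᵒᵖ) :
    (traceSequence hB i F).ShortExact :=
  (shortExact_iff _).2 ⟨traceIncl_injective hB i F, exists_traceIncl_eq hB i F,
    traceProj_surjective i F⟩

/-- Modules with a `Δ`-filtration have no higher extensions by a module without higher extensions
of the standard modules. -/
theorem HasDeltaFiltration.isExtAcyclic (hB : IsExhaustiveFiltration B) {n : ℕ}
    (hn : ∀ X, B n X) {F : LMod K Cᵒᵖ} (hF : HasDeltaFiltration B F) {N : LMod K Cᵒᵖ}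
    (hN : ∀ i X, IsExtAcyclic N (standard K B i X)) : IsExtAcyclic N F := by
  have key : ∀ i, IsExtAcyclic N (trace (B i) F).toLMod := by
    intro i
    induction i with
    | zero =>
      have : Projective (trace (B 0) F).toLMod := by
        refine (IsZero.iff_id_eq_zero _ |>.2 (lmod_hom_ext fun Y x => ?_)).projective
        exact Subtype.ext (trace_isZero_eq_zero (fun X => (hB.zero X).1) x.2)
      exact IsExtAcyclic.of_projective _
    | succ i ih =>
      obtain ⟨m, E, -, ⟨e⟩⟩ := hF i
      exact IsExtAcyclic.middle (traceSequence_shortExact hB.mono i F) ih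
        ((IsExtAcyclic.biproduct fun k => hN i (E k)).of_iso e)
  -- Finiteness of the filtration enters here: `F^(n)` is all of `F`, so the induction reaches `F`.
  have : IsIso (trace (B n) F).incl := isIso_of_bijective _ fun Y =>
    ⟨Sub.incl_injective _ Y, fun x => ⟨⟨x, mem_trace F (hn (unop Y)) x⟩, rfl⟩⟩
  exact (key n).of_iso (asIso (trace (B n) F).incl).symm

end Vanishing

end

end QuasiHereditary

theorem mainTheorem2 {K : Type v} [Field K] [IsAlgClosed K]
    {C : Type u} [Category.{v} C] [Preadditive C] [Linear K C] [HasFiniteBiproducts C]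
    [EssentiallySmall.{v} C]
    (hfin : QuasiHereditary.HomFinite K C) (hKS : QuasiHereditary.IsKrullSchmidt C)
    (B : ℕ → ObjectProperty C) (hB : QuasiHereditary.IsExhaustiveFiltration B)
    (hqh : QuasiHereditary.IsQuasiHereditary K B) :
    (∀ S : ShortComplex (QuasiHereditary.LMod K Cᵒᵖ), S.ShortExact →
      QuasiHereditary.HasDeltaFiltration B S.X₂ → QuasiHereditary.HasDeltaFiltration B S.X₃ →
      QuasiHereditary.HasDeltaFiltration B S.X₁) ∧
    ((∃ n, ∀ X, B n X) →
      ∀ F : QuasiHereditary.LMod K Cᵒᵖ, QuasiHereditary.HasDeltaFiltration B F →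
      ∀ t : ℕ, 1 ≤ t → ∀ (i : ℕ) (E : C), B (i + 1) E →
        Subsingleton (Abelian.Ext F (QuasiHereditary.costandard K B i E) t) ∧
        IsZero (QuasiHereditary.Tor t F (QuasiHereditary.standardOp K B i E))) := by
  refine ⟨fun S hS h₂ h₃ => h₂.of_shortExact hKS hB S hS h₃, ?_⟩
  rintro ⟨n, hn⟩ F hF t ht i E -
  have hExt := hF.isExtAcyclic hB hn
    (fun k X => QuasiHereditary.isExtAcyclic_standard hB hqh k i E X) t ht
  exact ⟨hExt, QuasiHereditary.isZero_tor_of_subsingleton_ext F _ t ht hExt⟩
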